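/- **Setting.** Let $\Omega\subset\mathbb R^d$ be compact, $\nu$ a Borel probability measure on $\Omega$, $\mathcal D_N=\{u_1,\dots,u_N\}\subset C(\Omega)$ a dictionary of real continuous functions, $\xi_1,\dots,\xi_m\in\Omega$, $1\le p<\infty$, $B>0$, and $F=\{f\in C(\Omega):\|f\|_{C(\Omega)}\le B\}$. Put $\tilde f^m=(f(\xi_1),\dots,f(\xi_m))^\top$, $\tilde D=(u_i(\xi_j))_{j,i}\in\mathbb R^{m\times N}$, $\|z\|_{p,m}=(\frac1m\sum_{j}|z_j|^p)^{1/p}$, and let $\|z\|_0$ be the number of nonzero entries of $z$. Let $\Sigma_s=\{\sum_i w_iu_i:\|w\|_0\le s\}$, and for a measure $\rho$ on $\Omega$ and $1\le q\le\infty$ let $$\sigma_s(F,\mathcal D_N)_{L_q(\Omega,\rho)}=\sup_{f\in F}\ \inf_{g\in\Sigma_s}\|f-g\|_{L_q(\Omega,\rho)}.$$ Let $\nu_\xi=\frac12\nu+\frac1{2m}\sum_{j=1}^m\delta_{\xi_j}$. Assume that the columns $a_1,\dots,a_N$ of $\tilde D$ are nonzero, and that the mutual coherence $\mu=\max_{i\ne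 j}\frac{|a_i^\top a_j|}{\|a_i\|_2\|a_j\|_2}$ is positive (as is automatic if $m<N$). A vector $w$ with $\|w\|_0\le s$ is called a best $s$-term coefficient vector of $f$ if it minimizes $\|\tilde f^m-\tilde Dw\|_{p,m}$ over all $w\in\mathbb R^N$ with $\|w\|_0\le s$. One-sided universal discretization with constant $C_1>0$ means $C_1\|g\|_{L_p(\Omega,\nu)}^p\le\frac1m\sum_{j=1}^m|g(\xi_j)|^p$ for all $g\in\Sigma_{2s}$. **Networks.** A convolution with kernel $w\in\mathbb R^k$ and stride $t\ge1$ maps $x\in\mathbb R^{d}$ to $(\sum_{l=1}^kw_lx_{(i-1)t+l})_{1\le i\le\lceil d/t\rceil}$, where $x$ is extended by zero. A convolutional layer maps several channels to several channels, each output channel being the sum of convolutions (same stride) of the input channels plus a bias constant along the channel. A block is a composition of layers with the ReLU after every layer except the last. A CNN with kernel size $k$ is a finite sequence of such blocks, all kernels having $k$ entries, the output of each block being flattened to a vector that is the (one-channel) input of the next. Its depth is the number of layers, its parameters are the nonzero kernel entries and biases. **Theorem.** There is an absolute constant $c>0$ such that, in the setting above, for all integers $m,s,J,N\ge1$ and $k\ge2$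 with $s<\bar s:=\frac12(1+\frac1\mu)$, there is a CNN $\Phi:\mathbb R^m\to\mathbb R^N$ with kernel size $k$, depth at most $c\,J\max\{1,\log_k(m+N)\}$ and at most $c\,J(m+N)^2$ nonzero parameters, such that for every $f\in F$: 1. $\|\Phi(\tilde f^m)\|_0\le s$; 2. a best $s$-term coefficient vector of $f$ exists, and every such vector $w$ satisfies, with $\sigma=\sigma_s(F,\mathcal D_N)_{L_p(\Omega,\nu_\xi)}$, and, if all $\xi_j$ lie in the support of $\nu$, also with $\sigma=\sigma_s(F,\mathcal D_N)_{L_\infty(\Omega,\nu)}$, $$\|w-\Phi(\tilde f^m)\|_p\le C_4e^{-C_5J}+C_6\,\sigma;$$ 3. for every $C_1>0$ for which one-sided universal discretization holds, $f_s:=\sum_{i=1}^N\Phi(\tilde f^m)_iu_i$ satisfies, for the same choices of $\sigma$, $$\|f-f_s\|_{L_p(\Omega,\nu)}\le C_7e^{-C_5J}+C_8\,\sigma.$$ Here, with $c_0=\max_i\|a_i\|_2^{-1}$, $C=2s\sum_{i=0}^J(2\mu s-\mu)^i$ and $C_{m,p}=\max\{1,m^{1/p-1/2}\}$, $$C_4=6c_0BmsN^{1-1/p},\qquad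 C_5=-\ln(2\mu s-\mu)>0,\qquad C_6=c_0C\,2^{1/p}mN^{1-1/p},$$ $$C_7=12\,C_1^{-1/p}C_{m,p}m^{1-1/p}Bs,\qquad C_8=2^{1+1/p}C\,C_1^{-1/p}C_{m,p}m^{1-1/p}+C_3,$$ $$C_3=2^{1/p}\bigl(1+2(1+C_1^{-1})^{1/p}\bigr)+2^{1/p}C_1^{-1/p}\bigl(2+2(1+C_1^{-1})^{1/p}\bigr).$$ -/

import Mathlib

open MeasureTheory
open scoped ENNReal

namespace SparseCNN

noncomputable section

/-! ### Convolutional networks -/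

/-- The rectified linear unit. -/
def relu (u : ℝ) : ℝ := max u 0

/-- One-dimensional convolution with kernel `w` of size `k` and stride `t`. With indices starting
from `0`, its `i`-th entry is `∑ l < k, w l * x (i * t + l)`, where `x` is extended by zero. The
output length `d'` is `⌈d / t⌉` in a layer (see `ConvLayer.len_eq`). -/
def conv {k d d' : ℕ} (w : Fin k → ℝ) (t : ℕ) (x : Fin d → ℝ) (i : Fin d') : ℝ :=
  ∑ l : Fin k, w l * (if h : i.val * t + l.val < d then x ⟨i.val * t + l.val, h⟩ else 0)

/-- The data of a convolutional layer with kernel size `k`, from `n` channels of length `d`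
to `n'` channels of length `d'`. -/
structure ConvLayer (k d n d' n' : ℕ) where
  /-- the stride -/
  stride : ℕ
  stride_pos : 0 < stride
  len_eq : d' = d ⌈/⌉ stride
  /-- `weight ℓ i` is the kernel from the input channel `i` to the output channel `ℓ` -/
  weight : Fin n' → Fin n → Fin k → ℝ
  /-- one bias for every output channel -/
  bias : Fin n' → ℝ

namespace ConvLayer

variable {k d n d' n' : ℕ}

/-- The affine map of a layer, before activation. -/
def affine (L : ConvLayer k d n d' n') (x : Fin n → Fin d → ℝ) : Fin n' → Fin d' → ℝ :=
  fun ℓ i => (∑ c, conv (L.weight ℓ c) L.stride (x c) i) + L.bias ℓ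

/-- The number of nonzero parameters (kernel entries and biases) of a layer. -/
def numParams (L : ConvLayer k d n d' n') : ℕ :=
  (∑ ℓ, ∑ c, hammingNorm (L.weight ℓ c)) + hammingNorm L.bias

end ConvLayer

/-- A multi-channel convolutional block with at least one layer, all kernels having size `k`, from
`n` channels of length `d` to `n'` channels of length `d'`. All layers but the last one are
followed by the activation. -/
inductive CNNBlock (k : ℕ) : ℕ → ℕ → ℕ → ℕ → Type
  | last {d n d' n' : ℕ} (L : ConvLayer k d n d' n') : CNNBlock k d n d' n'
  | cons {d n d₁ n₁ d' n' : ℕ} (L : ConvLayer k d n d₁ n₁) (T : CNNBlock k d₁ n₁ d' n') :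
      CNNBlock k d n d' n'

namespace CNNBlock

variable {k : ℕ}

/-- The function computed by a block. -/
def eval : {d n d' n' : ℕ} → CNNBlock k d n d' n' → (Fin n → Fin d → ℝ) → Fin n' → Fin d' → ℝ
  | _, _, _, _, last L, x => L.affine x
  | _, _, _, _, cons L T, x => T.eval (fun ℓ i => relu (L.affine x ℓ i))

/-- The number of layers of a block. -/
def depth : {d n d' n' : ℕ} → CNNBlock k d n d' n' → ℕ
  | _, _, _, _, last _ => 1
  | _, _, _, _, cons _ T => T.depth + 1

/-- The number of nonzero parameters of a block. -/
def numParams : {d n d' n' : ℕ} → CNNBlock k d n d' n' → ℕ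
  | _, _, _, _, last L => L.numParams
  | _, _, _, _, cons L T => L.numParams + T.numParams

end CNNBlock

/-- Flattening of `n` channels of length `d` to a vector, one channel after the other. -/
def flatten {n d D : ℕ} (h : D = n * d) (x : Fin n → Fin d → ℝ) (j : Fin D) : ℝ :=
  x (finProdFinEquiv.symm (Fin.cast h j)).1 (finProdFinEquiv.symm (Fin.cast h j)).2

/-- A convolutional network with kernel size `k`, input in `ℝ^d` and output in `ℝ^D`: a nonempty
finite sequence of blocks. The input of every block is a vector (one channel), and the output of
every block is flattened to a vector. -/
inductive CNN (k : ℕ) : ℕ → ℕ → Type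
  | last {d d' n' D : ℕ} (T : CNNBlock k d 1 d' n') (h : D = n' * d') : CNN k d D
  | cons {d d' n' D₁ D : ℕ} (T : CNNBlock k d 1 d' n') (h : D₁ = n' * d') (Φ : CNN k D₁ D) :
      CNN k d D

namespace CNN

variable {k : ℕ}

/-- The function computed by a network. -/
def eval : {d D : ℕ} → CNN k d D → (Fin d → ℝ) → Fin D → ℝ
  | _, _, last T h, x => flatten h (T.eval (fun _ => x))
  | _, _, cons T h Φ, x => Φ.eval (flatten h (T.eval (fun _ => x)))

/-- The total number of layers. -/
def depth : {d D : ℕ} → CNN k d D → ℕ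
  | _, _, last T _ => T.depth
  | _, _, cons T _ Φ => T.depth + Φ.depth

/-- The total number of nonzero parameters. -/
def numParams : {d D : ℕ} → CNN k d D → ℕ
  | _, _, last T _ => T.numParams
  | _, _, cons T _ Φ => T.numParams + Φ.numParams

end CNN

/-! ### Vectors and matrices -/

/-- The `ℓ_p` norm of a vector, for real `p ≥ 1`. -/
def vecNorm {n : ℕ} (p : ℝ) (z : Fin n → ℝ) : ℝ := (∑ i, |z i| ^ p) ^ (1 / p)

/-- The averaged empirical norm of a vector of `m` values. -/
def empNorm {m : ℕ} (p : ℝ) (z : Fin m → ℝ) : ℝ := (1 / (m : ℝ) * ∑ j, |z j| ^ p) ^ (1 / p)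

/-- The Euclidean norm of the `i`-th column. -/
def colNorm {m N : ℕ} (A : Matrix (Fin m) (Fin N) ℝ) (i : Fin N) : ℝ := √(∑ t, A t i ^ 2)

/-- The mutual coherence of a matrix (with nonzero columns): the maximum over the pairs of distinct
columns of the absolute value of their cosine. -/
def coherence {m N : ℕ} (A : Matrix (Fin m) (Fin N) ℝ) : ℝ :=
  ⨆ q : {q : Fin N × Fin N // q.1 ≠ q.2},
    |∑ t, A t q.1.1 * A t q.1.2| / (colNorm A q.1.1 * colNorm A q.1.2)

/-- The threshold `s̄` for the sparsity. -/
def sBar {m N : ℕ} (A : Matrix (Fin m) (Fin N) ℝ) : ℝ := (1 + 1 / coherence A) / 2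

/-- `w` minimizes `‖y - A w‖` in the empirical norm over all vectors with at most `s` nonzero
entries. -/
def IsBestCoeff {m N : ℕ} (p : ℝ) (s : ℕ) (A : Matrix (Fin m) (Fin N) ℝ) (y : Fin m → ℝ)
    (w : Fin N → ℝ) : Prop :=
  hammingNorm w ≤ s ∧
    ∀ v : Fin N → ℝ, hammingNorm v ≤ s →
      empNorm p (fun j => y j - A.mulVec w j) ≤ empNorm p (fun j => y j - A.mulVec v j)

/-! ### Sparse approximation -/

section Approx

variable {Ω : Type*} [TopologicalSpace Ω] [MeasurableSpace Ω] {m N : ℕ}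

/-- The values of `f` at the sample points. -/
def sample (ξ : Fin m → Ω) (f : C(Ω, ℝ)) : Fin m → ℝ := fun j => f (ξ j)

/-- The matrix whose columns are the sampled dictionary elements. -/
def dictMatrix (ξ : Fin m → Ω) (u : Fin N → C(Ω, ℝ)) : Matrix (Fin m) (Fin N) ℝ :=
  Matrix.of fun j i => u i (ξ j)

/-- The linear combination of dictionary elements with coefficients `w`. -/
def combo (u : Fin N → C(Ω, ℝ)) (w : Fin N → ℝ) : C(Ω, ℝ) := ∑ i, w i • u i

/-- The set of `s`-sparse combinations of dictionary elements. -/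
def sparseSet (u : Fin N → C(Ω, ℝ)) (s : ℕ) : Set C(Ω, ℝ) :=
  {g | ∃ w : Fin N → ℝ, hammingNorm w ≤ s ∧ g = combo u w}

/-- The norm of a continuous function in `L_q(Ω, ρ)`; for `q = ∞` the essential supremum. -/
def LNorm (q : ℝ≥0∞) (ρ : Measure Ω) (f : C(Ω, ℝ)) : ℝ := (eLpNorm f q ρ).toReal

/-- The error of best `s`-term approximation of `f` in `L_q(Ω, ρ)`. -/
def bestErr (u : Fin N → C(Ω, ℝ)) (s : ℕ) (q : ℝ≥0∞) (ρ : Measure Ω) (f : C(Ω, ℝ)) : ℝ :=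
  sInf ((fun g => LNorm q ρ (f - g)) '' sparseSet u s)

/-- The worst-case error of best `s`-term approximation over `F` in `L_q(Ω, ρ)`. -/
def worstErr (u : Fin N → C(Ω, ℝ)) (s : ℕ) (q : ℝ≥0∞) (ρ : Measure Ω) (F : Set C(Ω, ℝ)) : ℝ :=
  sSup (bestErr u s q ρ '' F)

/-- The measure `ν / 2 + (1 / (2 m)) ∑ j, δ_{ξ j}`. -/
def mixedMeasure (ν : Measure Ω) (ξ : Fin m → Ω) : Measure Ω :=
  (2 : ℝ≥0∞)⁻¹ • ν + (2 * (m : ℝ≥0∞))⁻¹ • ∑ j, Measure.dirac (ξ j)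

/-- One-sided universal discretization of the `L_p(Ω, ν)` norm on the `2s`-sparse combinations,
with constant `C₁`. -/
def OneSidedUD (ν : Measure Ω) (ξ : Fin m → Ω) (u : Fin N → C(Ω, ℝ)) (s : ℕ) (p C₁ : ℝ) : Prop :=
  0 < C₁ ∧ ∀ g ∈ sparseSet u (2 * s),
    C₁ * LNorm (ENNReal.ofReal p) ν g ^ p ≤ 1 / (m : ℝ) * ∑ j, |g (ξ j)| ^ p

end Approx

/-! ### The constants -/

section Constants

variable {m N : ℕ}

/-- The largest reciprocal of the Euclidean norm of a column. -/
def c0 (A : Matrix (Fin m) (Fin N) ℝ) : ℝ := ⨆ i : Fin N, 1 / colNorm A i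

/-- `2 s ∑_{i=0}^{J} (2 μ s - μ)^i` with `μ` the coherence. -/
def geomConst (A : Matrix (Fin m) (Fin N) ℝ) (s J : ℕ) : ℝ :=
  2 * s * ∑ i ∈ Finset.range (J + 1), (2 * coherence A * s - coherence A) ^ i

/-- `max {1, m^{1/p - 1/2}}`. -/
def Cmp (m : ℕ) (p : ℝ) : ℝ := max 1 ((m : ℝ) ^ (1 / p - 1 / 2))

def C3 (p C₁ : ℝ) : ℝ :=
  2 ^ (1 / p) * (1 + 2 * (1 + C₁⁻¹) ^ (1 / p)) +
    2 ^ (1 / p) * C₁ ^ (-(1 / p)) * (2 + 2 * (1 + C₁⁻¹) ^ (1 / p))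

def C4 (A : Matrix (Fin m) (Fin N) ℝ) (s : ℕ) (p B : ℝ) : ℝ :=
  6 * c0 A * B * m * s * (N : ℝ) ^ (1 - 1 / p)

def C5 (A : Matrix (Fin m) (Fin N) ℝ) (s : ℕ) : ℝ :=
  -Real.log (2 * coherence A * s - coherence A)

def C6 (A : Matrix (Fin m) (Fin N) ℝ) (s J : ℕ) (p : ℝ) : ℝ :=
  c0 A * geomConst A s J * 2 ^ (1 / p) * m * (N : ℝ) ^ (1 - 1 / p)

def C7 (m s : ℕ) (p B C₁ : ℝ) : ℝ :=
  12 * C₁ ^ (-(1 / p)) * Cmp m p * (m : ℝ) ^ (1 - 1 / p) * B * s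

def C8 (A : Matrix (Fin m) (Fin N) ℝ) (s J : ℕ) (p C₁ : ℝ) : ℝ :=
  2 ^ (1 + 1 / p) * geomConst A s J * C₁ ^ (-(1 / p)) * Cmp m p * (m : ℝ) ^ (1 - 1 / p) + C3 p C₁

end Constants

end

end SparseCNN

open SparseCNN

/-!
The network performs `J` steps of iterative soft thresholding for the matrix with normalized columns
`Ã`, started at `x = 0`:
`x ↦ soft θ (x + Ãᵀ (y - Ã x))`.

*Recovery.* Let `w` be `s`-sparse, `w̃` its coefficients with respect to the normalized columns, and
`y = A w + e`. If `x` vanishes outside the support of `w` and `‖w̃ - x‖₁ ≤ δ`, then, with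
`μ` the coherence and `ε ≥ ‖e‖₁`, the argument of the thresholding is at most `μ δ + ε` outside the
support of `w`. With the threshold `θ = μ δ + ε` no false entries arise, and the new error is at
most `(2 μ s - μ) δ + 2 s ε` (`soft_step`). The thresholds depend only on a priori bounds for the
initial error and the noise. For best coefficients of functions bounded by `B` these bounds are
`‖w̃‖₁ ≤ 4 B m s`, by diagonal dominance of the Gram matrix (`sum_colNorm_mul_le`), and
`ε = m 2^(1/p) σ`, where `σ` is the worst-case error for the mixed measure
(`empNorm_residual_le_worstErr`). The error for the essential supremum dominates this `σ` if all
sample points lie in the support of the measure (`worstErr_mixed_le_top`), so one network serves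
both estimates.

*Architecture.* A single block suffices. Real numbers are carried through the activation as pairs
`relu v`, `relu (-v)` in two channels. Layers with stride `k` divide the length by `k` and sort the
entries of the input by their residues modulo powers of `k`, one residue per channel; after
`⌈log_k (m + N)⌉` of them each channel holds one number, and there are `m + N` pairs of channels
(`exists_gather_block`). The input extended by zero is then the pair `(y, 0)`. On channels of length
one convolutional layers are arbitrary affine maps, so that a soft thresholding step of `(y, x)`
takes one layer (`exists_iter_block`).

*Approximation.* The error in the continuous norm is split at the combination with best
coefficients. Its own error is compared with that of an arbitrary sparse combination
(`LNorm_residual_le_worstErr`); the remaining `2 s`-sparse difference is controlled by its samples,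
hence by the `ℓ₁` error of the coefficients (`empNorm_mulVec_le`).
-/

namespace SparseCNN

noncomputable section

/-! ### Convolutional layers from unit kernels -/

/-- Extension of a vector by zero to a function on `ℕ`. -/
def zeroExtend {d : ℕ} (x : Fin d → ℝ) (i : ℕ) : ℝ := if h : i < d then x ⟨i, h⟩ else 0

lemma zeroExtend_of_lt {d : ℕ} (x : Fin d → ℝ) {i : ℕ} (h : i < d) :
    zeroExtend x i = x ⟨i, h⟩ := dif_pos h

lemma zeroExtend_of_le {d : ℕ} (x : Fin d → ℝ) {i : ℕ} (h : d ≤ i) : zeroExtend x i = 0 :=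
  dif_neg (by omega)

lemma conv_single {k d d' : ℕ} (l : Fin k) (a : ℝ) (t : ℕ) (x : Fin d → ℝ) (i : Fin d') :
    conv (Pi.single l a) t x i = a * zeroExtend x (i * t + l) := by
  unfold conv
  rw [Finset.sum_eq_single l]
  · simp [zeroExtend]
  · intro b _ hb
    simp [Pi.single_eq_of_ne hb]
  · simp

lemma conv_zero {k d d' : ℕ} (t : ℕ) (x : Fin d → ℝ) (i : Fin d') :
    conv (0 : Fin k → ℝ) t x i = 0 := by
  simp [conv]

lemma hammingNorm_single_le {ι : Type*} [Fintype ι] [DecidableEq ι] (l : ι) (a : ℝ) :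
    hammingNorm (Pi.single l a : ι → ℝ) ≤ 1 := by
  unfold hammingNorm
  refine (Finset.card_le_card (t := {l}) ?_).trans (by simp)
  intro i hi
  by_contra h
  simp only [Finset.mem_singleton] at h
  simp [Pi.single_eq_of_ne h] at hi

lemma hammingNorm_fin_le {n : ℕ} (b : Fin n → ℝ) : hammingNorm b ≤ n :=
  hammingNorm_le_card_fintype.trans (by simp)

lemma relu_nonneg (u : ℝ) : 0 ≤ relu u := le_max_right _ _

lemma relu_of_nonneg {u : ℝ} (h : 0 ≤ u) : relu u = u := max_eq_left h

lemma relu_zero : relu 0 = 0 := relu_of_nonneg le_rfl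

lemma relu_relu (u : ℝ) : relu (relu u) = relu u := relu_of_nonneg (relu_nonneg u)

lemma relu_sub_relu_neg (u : ℝ) : relu u - relu (-u) = u := by
  unfold relu
  rcases le_total 0 u with h | h
  · rw [max_eq_left h, max_eq_right (by linarith)]; ring
  · rw [max_eq_right h, max_eq_left (by linarith)]; ring

/-- The sign of a channel: the channels of the networks below come in pairs, one for the positive
and one for the negative part of the represented number. -/
def sgn (σ : Fin 2) : ℝ := ![1, -1] σ

/-- The layer of stride one that sends a vector `x` to the `2 M` channels `x` and `-x`. -/
def splitLayer {k : ℕ} (hk : 0 < k) (d M : ℕ) : ConvLayer k d 1 d (2 * M) where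
  stride := 1
  stride_pos := one_pos
  len_eq := by simp
  weight ℓ _ := Pi.single ⟨0, hk⟩ (sgn (finProdFinEquiv.symm ℓ).1)
  bias := 0

lemma splitLayer_affine {k : ℕ} (hk : 0 < k) (d M : ℕ) (x : Fin 1 → Fin d → ℝ) (σ : Fin 2)
    (r : Fin M) (i : Fin d) :
    (splitLayer hk d M).affine x (finProdFinEquiv (σ, r)) i = sgn σ * x 0 i := by
  simp only [ConvLayer.affine, splitLayer, Equiv.symm_apply_apply, conv_single]
  simp [zeroExtend]

lemma splitLayer_numParams {k : ℕ} (hk : 0 < k) (d M : ℕ) :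
    (splitLayer hk d M).numParams ≤ 2 * M := by
  simp only [ConvLayer.numParams, splitLayer, hammingNorm_zero, add_zero]
  refine (Finset.sum_le_card_nsmul _ _ 1 fun ℓ _ => ?_).trans (by simp)
  simpa using hammingNorm_single_le _ _

/-- The layer of stride `k` which, in each half of the channels, moves the entry number
`i * k + r / k ^ j` of the channel `r % k ^ j` to the entry number `i` of the channel `r`. -/
def gatherLayer (k j d M : ℕ) (hk : 0 < k) : ConvLayer k d (2 * M) (d ⌈/⌉ k) (2 * M) where
  stride := k
  stride_pos := hk
  len_eq := rfl
  weight ℓ c :=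
    if h : (finProdFinEquiv.symm ℓ).2.val / k ^ j < k then
      if c = finProdFinEquiv ((finProdFinEquiv.symm ℓ).1,
          ⟨(finProdFinEquiv.symm ℓ).2.val % k ^ j,
            (Nat.mod_le _ _).trans_lt (finProdFinEquiv.symm ℓ).2.isLt⟩)
        then Pi.single ⟨_, h⟩ 1 else 0
    else 0
  bias := 0

lemma gatherLayer_affine {k j d M : ℕ} (hk : 0 < k) (z : Fin (2 * M) → Fin d → ℝ) (σ : Fin 2)
    (r : Fin M) (h : r.val / k ^ j < k) (i : Fin (d ⌈/⌉ k)) :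
    (gatherLayer k j d M hk).affine z (finProdFinEquiv (σ, r)) i =
      zeroExtend (z (finProdFinEquiv (σ, ⟨r.val % k ^ j, (Nat.mod_le _ _).trans_lt r.isLt⟩)))
        (i * k + r / k ^ j) := by
  simp only [ConvLayer.affine, gatherLayer, Equiv.symm_apply_apply, dif_pos h]
  rw [Finset.sum_eq_single
    (finProdFinEquiv (σ, ⟨r.val % k ^ j, (Nat.mod_le _ _).trans_lt r.isLt⟩))]
  · simp [conv_single]
  · intro b _ hb
    rw [if_neg hb, conv_zero]
  · simp

lemma gatherLayer_numParams (k j d M : ℕ) (hk : 0 < k) :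
    (gatherLayer k j d M hk).numParams ≤ 2 * M := by
  simp only [ConvLayer.numParams, gatherLayer, hammingNorm_zero, add_zero]
  refine (Finset.sum_le_card_nsmul _ _ 1 fun ℓ _ => ?_).trans (by simp)
  split_ifs with h
  · rw [Finset.sum_eq_single (finProdFinEquiv ((finProdFinEquiv.symm ℓ).1,
          ⟨(finProdFinEquiv.symm ℓ).2.val % k ^ j,
            (Nat.mod_le _ _).trans_lt (finProdFinEquiv.symm ℓ).2.isLt⟩))]
    · rw [if_pos rfl]
      exact hammingNorm_single_le _ _
    · intro b _ hb
      rw [if_neg hb, hammingNorm_zero]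
    · simp
  · simp

/-- The fully connected layer with matrix `W` and bias `b`, on channels of length one. -/
def denseLayer {k : ℕ} (hk : 0 < k) {n n' : ℕ} (W : Matrix (Fin n') (Fin n) ℝ)
    (b : Fin n' → ℝ) : ConvLayer k 1 n 1 n' where
  stride := 1
  stride_pos := one_pos
  len_eq := by simp
  weight ℓ c := Pi.single ⟨0, hk⟩ (W ℓ c)
  bias := b

lemma denseLayer_affine {k : ℕ} (hk : 0 < k) {n n' : ℕ} (W : Matrix (Fin n') (Fin n) ℝ)
    (b : Fin n' → ℝ) (h : Fin n → Fin 1 → ℝ) (ℓ : Fin n') (i : Fin 1) :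
    (denseLayer hk W b).affine h ℓ i = ∑ c, W ℓ c * h c 0 + b ℓ := by
  have hi : i = 0 := Subsingleton.elim _ _
  subst hi
  simp only [ConvLayer.affine, denseLayer, conv_single]
  simp [zeroExtend]

lemma denseLayer_numParams {k : ℕ} (hk : 0 < k) {n n' : ℕ} (W : Matrix (Fin n') (Fin n) ℝ)
    (b : Fin n' → ℝ) : (denseLayer hk W b).numParams ≤ n' * n + n' := by
  simp only [ConvLayer.numParams, denseLayer]
  refine add_le_add ?_ (hammingNorm_fin_le b)
  refine (Finset.sum_le_card_nsmul _ _ n fun ℓ _ => ?_).trans (by simp)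
  exact (Finset.sum_le_card_nsmul _ _ 1 fun c _ => hammingNorm_single_le _ _).trans (by simp)

/-! ### Moving a vector into channels of length one -/

/-- The channels of `z` hold the positive and negative parts of `x`, grouped modulo `k ^ j`: entry
`i` of channel `r < k ^ j` is the entry `i * k ^ j + r` of `x`. -/
def Gathered (k j : ℕ) {m d M : ℕ} (x : Fin m → ℝ) (z : Fin (2 * M) → Fin d → ℝ) : Prop :=
  ∀ (σ : Fin 2) (r : Fin M), r.val < k ^ j → ∀ i : ℕ,
    zeroExtend (z (finProdFinEquiv (σ, r))) i = relu (sgn σ * zeroExtend x (i * k ^ j + r))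

lemma gathered_split {k m M : ℕ} (hk : 0 < k) (x : Fin m → ℝ) :
    Gathered k 0 x (fun ℓ i => relu ((splitLayer hk m M).affine (fun _ => x) ℓ i)) := by
  intro σ r hr i
  have hr0 : r.val = 0 := by simpa using hr
  simp only [pow_zero, mul_one, hr0, add_zero]
  by_cases hi : i < m
  · rw [zeroExtend_of_lt _ hi, zeroExtend_of_lt _ hi, splitLayer_affine]
  · rw [zeroExtend_of_le _ (by omega), zeroExtend_of_le _ (by omega), mul_zero, relu_zero]

lemma Gathered.step {k j m d M : ℕ} (hk : 0 < k) {x : Fin m → ℝ} {z : Fin (2 * M) → Fin d → ℝ}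
    (hz : Gathered k j x z) (hd : m ≤ d * k ^ j) :
    Gathered k (j + 1) x (fun ℓ i => relu ((gatherLayer k j d M hk).affine z ℓ i)) := by
  intro σ r hr i
  have hkj : 0 < k ^ j := pow_pos hk j
  have hq : r.val / k ^ j < k := by
    rw [Nat.div_lt_iff_lt_mul hkj]
    rwa [pow_succ, mul_comm] at hr
  have hidx : i * k ^ (j + 1) + r = (i * k + r / k ^ j) * k ^ j + r % k ^ j := by
    have := Nat.div_add_mod' r.val (k ^ j)
    rw [add_mul, add_assoc, this, pow_succ]
    ring
  have key := hz σ ⟨r.val % k ^ j, (Nat.mod_le _ _).trans_lt r.isLt⟩ (Nat.mod_lt _ hkj)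
    (i * k + r / k ^ j)
  by_cases hi : i < d ⌈/⌉ k
  · rw [zeroExtend_of_lt _ hi]
    dsimp only
    rw [gatherLayer_affine hk z σ r hq, key, relu_relu, hidx]
  · rw [zeroExtend_of_le _ (by omega)]
    have h1 : d ≤ k * i := by
      have h2 : d ⌈/⌉ k ≤ i := by omega
      exact (ceilDiv_le_iff_le_smul hk).1 h2
    have h3 : m ≤ i * k ^ (j + 1) + r :=
      calc m ≤ d * k ^ j := hd
        _ ≤ (k * i) * k ^ j := Nat.mul_le_mul_right _ h1
        _ = i * k ^ (j + 1) := by ring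
        _ ≤ _ := Nat.le_add_right _ _
    rw [zeroExtend_of_le x h3, mul_zero, relu_zero]

/-- A block on channels of length one can be preceded by `L` gathering layers. -/
lemma exists_gather_block {k m M n' : ℕ} (hk : 0 < k) (T : CNNBlock k 1 (2 * M) 1 n') (L : ℕ) :
    ∀ (j d : ℕ), 1 ≤ d → d ≤ k ^ L → m ≤ d * k ^ j →
      ∃ T' : CNNBlock k d (2 * M) 1 n', T'.depth = T.depth + L ∧
        T'.numParams ≤ T.numParams + L * (2 * M) ∧
        ∀ (x : Fin m → ℝ) (z : Fin (2 * M) → Fin d → ℝ), Gathered k j x z →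
          ∃ h : Fin (2 * M) → Fin 1 → ℝ, Gathered k (j + L) x h ∧ T'.eval z = T.eval h := by
  induction L with
  | zero =>
    intro j d hd1 hd2 _
    have hd : d = 1 := le_antisymm (by simpa using hd2) hd1
    subst hd
    exact ⟨T, rfl, by simp, fun x z hz => ⟨z, hz, rfl⟩⟩
  | succ L ih =>
    intro j d hd1 hd2 hm
    have h1 : d ≤ k * (d ⌈/⌉ k) := by
      have := le_smul_ceilDiv (b := d) hk
      simpa using this
    have h2 : 1 ≤ d ⌈/⌉ k := by
      rcases Nat.eq_zero_or_pos (d ⌈/⌉ k) with h0 | h0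
      · rw [h0] at h1; omega
      · exact h0
    have h3 : d ⌈/⌉ k ≤ k ^ L := by
      rw [ceilDiv_le_iff_le_smul hk]
      simpa [pow_succ, mul_comm] using hd2
    have h4 : m ≤ (d ⌈/⌉ k) * k ^ (j + 1) :=
      calc m ≤ d * k ^ j := hm
        _ ≤ (k * (d ⌈/⌉ k)) * k ^ j := Nat.mul_le_mul_right _ h1
        _ = _ := by ring
    obtain ⟨T', hT1, hT2, hT3⟩ := ih (j + 1) (d ⌈/⌉ k) h2 h3 h4
    refine ⟨CNNBlock.cons (gatherLayer k j d M hk) T', ?_, ?_, ?_⟩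
    · simp only [CNNBlock.depth, hT1]; ring
    · simp only [CNNBlock.numParams]
      have := gatherLayer_numParams k j d M hk
      rw [add_mul]
      omega
    · intro x z hz
      obtain ⟨h, hh, he⟩ := hT3 x _ (hz.step hk hm)
      refine ⟨h, ?_, he⟩
      have : j + (L + 1) = j + 1 + L := by ring
      rwa [this]

/-! ### Soft thresholding iterations as networks -/

/-- The soft thresholding function with threshold `θ` (for `0 ≤ θ`). -/
def soft (θ u : ℝ) : ℝ := relu (u - θ) - relu (-u - θ)

lemma soft_zero (u : ℝ) : soft 0 u = u := by
  simpa [soft] using relu_sub_relu_neg u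

/-- The iterates of `v ↦ soft (Q v)`, with varying thresholds. -/
def softIter {α : Type*} [Fintype α] (Q : Matrix α α ℝ) (θ : ℕ → α → ℝ) (v : α → ℝ) :
    ℕ → α → ℝ
  | 0 => v
  | t + 1 => fun a => soft (θ t a) (Q.mulVec (softIter Q θ v t) a)

/-- The vector represented by channels of length one: the difference of the two halves. -/
def decode {M : ℕ} (h : Fin (2 * M) → Fin 1 → ℝ) (a : Fin M) : ℝ :=
  h (finProdFinEquiv (0, a)) 0 - h (finProdFinEquiv (1, a)) 0

/-- The matrix that applies `Q` to the represented vector, multiplied by a sign for every row. -/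
def signedMatrix {M n' : ℕ} (Q : Matrix (Fin n') (Fin M) ℝ) (τ : Fin n' → ℝ) :
    Matrix (Fin n') (Fin (2 * M)) ℝ :=
  Matrix.of fun ℓ c => τ ℓ * (sgn (finProdFinEquiv.symm c).1 * Q ℓ (finProdFinEquiv.symm c).2)

lemma signedMatrix_sum {M n' : ℕ} (Q : Matrix (Fin n') (Fin M) ℝ) (τ : Fin n' → ℝ)
    (h : Fin (2 * M) → Fin 1 → ℝ) (ℓ : Fin n') :
    ∑ c, signedMatrix Q τ ℓ c * h c 0 = τ ℓ * Q.mulVec (decode h) ℓ := by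
  rw [← Equiv.sum_comp finProdFinEquiv, Fintype.sum_prod_type]
  simp only [signedMatrix, Matrix.of_apply, Equiv.symm_apply_apply, Fin.sum_univ_two, sgn,
    Matrix.mulVec, dotProduct, decode, Finset.mul_sum, ← Finset.sum_add_distrib]
  refine Finset.sum_congr rfl fun a _ => ?_
  simp
  ring

/-- A block on channels of length one can be preceded by `J` layers which perform `J` soft
thresholding iterations on the represented vector. -/
lemma exists_iter_block {k M n' : ℕ} (hk : 0 < k) (Q : Matrix (Fin M) (Fin M) ℝ)
    (θ : ℕ → Fin M → ℝ) (J : ℕ) :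
    ∀ T : CNNBlock k 1 (2 * M) 1 n', ∃ T' : CNNBlock k 1 (2 * M) 1 n',
      T'.depth = T.depth + J ∧
      T'.numParams ≤ T.numParams + J * (2 * M * (2 * M) + 2 * M) ∧
      ∀ h : Fin (2 * M) → Fin 1 → ℝ, ∃ h' : Fin (2 * M) → Fin 1 → ℝ,
        decode h' = softIter Q θ (decode h) J ∧ T'.eval h = T.eval h' := by
  induction J with
  | zero => exact fun T => ⟨T, rfl, by simp, fun h => ⟨h, rfl, rfl⟩⟩
  | succ J ih =>
    intro T
    set L : ConvLayer k 1 (2 * M) 1 (2 * M) := denseLayer hk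
      (signedMatrix (Matrix.of fun ℓ => Q (finProdFinEquiv.symm ℓ).2)
        (fun ℓ => sgn (finProdFinEquiv.symm ℓ).1))
      (fun ℓ => -θ J (finProdFinEquiv.symm ℓ).2) with hL
    obtain ⟨T', h1, h2, h3⟩ := ih (CNNBlock.cons L T)
    refine ⟨T', ?_, ?_, fun h => ?_⟩
    · rw [h1, CNNBlock.depth]; ring
    · have h4 : L.numParams ≤ 2 * M * (2 * M) + 2 * M := denseLayer_numParams _ _ _
      rw [CNNBlock.numParams] at h2
      rw [add_mul]
      omega
    · obtain ⟨h', hd, he⟩ := h3 h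
      refine ⟨fun ℓ i => relu (L.affine h' ℓ i), ?_, he⟩
      funext a
      have key : ∀ σ : Fin 2, L.affine h' (finProdFinEquiv (σ, a)) 0 =
          sgn σ * Q.mulVec (decode h') a - θ J a := by
        intro σ
        rw [hL, denseLayer_affine, signedMatrix_sum]
        simp only [Equiv.symm_apply_apply, Matrix.mulVec, Matrix.of_apply]
        ring
      simp only [decode, key]
      rw [softIter, ← hd]
      simp [soft, sgn]

/-- Soft thresholding iterations, started at the zero extension of the input, followed by a linear
map, are computed by a convolutional network with one block. -/
theorem exists_cnn_softIter {k m M N : ℕ} (hk : 1 < k) (hm : 1 ≤ m) (hM : m ≤ M)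
    (Q : Matrix (Fin M) (Fin M) ℝ) (R : Matrix (Fin N) (Fin M) ℝ) (θ : ℕ → Fin M → ℝ) (J : ℕ) :
    ∃ Φ : CNN k m N, Φ.depth = Nat.clog k M + J + 2 ∧
      Φ.numParams ≤ 2 * M + Nat.clog k M * (2 * M) + J * (2 * M * (2 * M) + 2 * M) +
        (N * (2 * M) + N) ∧
      ∀ x : Fin m → ℝ,
        Φ.eval x = R.mulVec (softIter Q θ (fun a => zeroExtend x a) J) := by
  have hk0 : 0 < k := by omega
  set L₀ : ConvLayer k 1 (2 * M) 1 N := denseLayer hk0 (signedMatrix R 1) 0 with hL₀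
  obtain ⟨T₁, hT₁d, hT₁p, hT₁⟩ := exists_iter_block hk0 Q θ J (CNNBlock.last L₀)
  obtain ⟨T₂, hT₂d, hT₂p, hT₂⟩ := exists_gather_block (m := m) hk0 T₁ (Nat.clog k M) 0 m hm
    (hM.trans (Nat.le_pow_clog hk M)) (by simp)
  refine ⟨CNN.last (CNNBlock.cons (splitLayer hk0 m M) T₂) (by simp), ?_, ?_, fun x => ?_⟩
  · simp only [CNN.depth, CNNBlock.depth, hT₂d, hT₁d]
    ring
  · have h1 := splitLayer_numParams hk0 m M
    have h2 : L₀.numParams ≤ N * (2 * M) + N := denseLayer_numParams _ _ _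
    simp only [CNN.numParams, CNNBlock.numParams] at hT₁p ⊢
    omega
  · obtain ⟨h, hg, he⟩ := hT₂ x _ (gathered_split hk0 x)
    obtain ⟨h', hd, he'⟩ := hT₁ h
    have hdec : decode h = fun a : Fin M => zeroExtend x a := by
      funext a
      have key : ∀ σ : Fin 2, h (finProdFinEquiv (σ, a)) 0 = relu (sgn σ * zeroExtend x a) := by
        intro σ
        have hlt : a.val < k ^ (0 + Nat.clog k M) := by
          rw [zero_add]
          exact a.isLt.trans_le (Nat.le_pow_clog hk M)
        simpa [zeroExtend_of_lt] using hg σ a hlt 0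
      simp only [decode, key]
      simpa [sgn] using relu_sub_relu_neg (zeroExtend x a)
    funext j
    simp only [CNN.eval, CNNBlock.eval, flatten]
    rw [he, he', CNNBlock.eval, hL₀, denseLayer_affine, signedMatrix_sum, hd, hdec]
    have hj : (finProdFinEquiv.symm (Fin.cast (by simp : N = N * 1) j)).1 = j := by
      ext
      simp [finProdFinEquiv, Fin.divNat]
    rw [hj]
    simp

/-! ### Sparse recovery by soft thresholding -/

lemma soft_eq_zero {θ u : ℝ} (h : |u| ≤ θ) : soft θ u = 0 := by
  obtain ⟨h1, h2⟩ := abs_le.1 h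
  rw [soft, relu, relu, max_eq_right (by linarith), max_eq_right (by linarith), sub_zero]

lemma abs_soft_sub_le {θ : ℝ} (hθ : 0 ≤ θ) (u : ℝ) : |soft θ u - u| ≤ θ := by
  unfold soft relu
  rw [abs_le]
  constructor <;>
  rcases max_cases (u - θ) 0 with ⟨h1, h1'⟩ | ⟨h1, h1'⟩ <;>
  rcases max_cases (-u - θ) 0 with ⟨h2, h2'⟩ | ⟨h2, h2'⟩ <;> rw [h1, h2] <;> linarith

variable {m N : ℕ}

lemma card_filter_ne_zero_le {s : ℕ} {w : Fin N → ℝ} (hw : hammingNorm w ≤ s) :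
    ((Finset.univ.filter fun i => w i ≠ 0).card : ℝ) ≤ s := by
  exact_mod_cast hw

/-- Summing over the support of an `s`-sparse vector the off-diagonal contributions of a matrix
with entries at most `μ`: each entry of `D` is counted at most `s - 1` times. -/
lemma sum_support_le {s : ℕ} (hs : 1 ≤ s) {w D : Fin N → ℝ} (hw : hammingNorm w ≤ s)
    (hD : ∀ i, 0 ≤ D i) (hD0 : ∀ i, w i = 0 → D i = 0) {δ μ κ : ℝ} (hμ : 0 ≤ μ) (hκ : 0 ≤ κ)
    (hδ : ∑ i, D i ≤ δ) {F : Fin N → ℝ} (hF0 : ∀ i, w i = 0 → F i = 0)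
    (hF : ∀ i, F i ≤ μ * (∑ j, D j - D i) + κ) :
    ∑ i, F i ≤ μ * (s - 1) * δ + s * κ := by
  classical
  set S := Finset.univ.filter fun i => w i ≠ 0 with hS
  have hc : (S.card : ℝ) ≤ s := card_filter_ne_zero_le hw
  have hs' : (1 : ℝ) ≤ s := by exact_mod_cast hs
  have hsub : ∀ H : Fin N → ℝ, (∀ i, w i = 0 → H i = 0) → ∑ i ∈ S, H i = ∑ i, H i := by
    intro H hH
    refine Finset.sum_subset (Finset.subset_univ _) fun i _ hi => hH i ?_
    simpa [hS] using hi
  have hX : 0 ≤ ∑ j, D j := Finset.sum_nonneg fun i _ => hD i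
  calc ∑ i, F i = ∑ i ∈ S, F i := (hsub F hF0).symm
    _ ≤ ∑ i ∈ S, (μ * (∑ j, D j - D i) + κ) := Finset.sum_le_sum fun i _ => hF i
    _ = μ * (S.card * ∑ j, D j - ∑ j, D j) + S.card * κ := by
        rw [Finset.sum_add_distrib, ← Finset.mul_sum, Finset.sum_sub_distrib, hsub D hD0]
        simp
    _ ≤ μ * (s * ∑ j, D j - ∑ j, D j) + s * κ := by gcongr
    _ = μ * ((s - 1) * ∑ j, D j) + s * κ := by ring
    _ ≤ μ * ((s - 1) * δ) + s * κ := by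
        have : (0 : ℝ) ≤ s - 1 := by linarith
        gcongr
    _ = _ := by ring

lemma abs_sum_erase_le {g D : Fin N → ℝ} {μ : ℝ} {i : Fin N} (hg : ∀ j, i ≠ j → |g j| ≤ μ) :
    |∑ j ∈ Finset.univ.erase i, g j * D j| ≤ μ * (∑ j, |D j| - |D i|) := by
  rw [← Finset.sum_erase_eq_sub (Finset.mem_univ i), Finset.mul_sum]
  refine (Finset.abs_sum_le_sum_abs _ _).trans (Finset.sum_le_sum fun j hj => ?_)
  rw [abs_mul]
  exact mul_le_mul_of_nonneg_right (hg j (Finset.ne_of_mem_erase hj).symm) (abs_nonneg _)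

/-- One step of soft thresholding: with the threshold `μ δ + ε` no new entries appear outside the
support of `w`, and the `ℓ₁` error `δ` is contracted by `2 μ s - μ`, up to the noise. -/
lemma soft_step {s : ℕ} (hs : 1 ≤ s) {g : Fin N → Fin N → ℝ} {μ ε δ : ℝ} (hμ : 0 ≤ μ)
    (hε : 0 ≤ ε) (hg : ∀ i j, i ≠ j → |g i j| ≤ μ) {w x x' e : Fin N → ℝ}
    (hw : hammingNorm w ≤ s) (hx : ∀ i, w i = 0 → x i = 0) (hδ : ∑ i, |w i - x i| ≤ δ)
    (he : ∀ i, |e i| ≤ ε)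
    (hx' : ∀ i, x' i = soft (μ * δ + ε)
      (w i + ∑ j ∈ Finset.univ.erase i, g i j * (w j - x j) + e i)) :
    (∀ i, w i = 0 → x' i = 0) ∧
      ∑ i, |w i - x' i| ≤ (2 * μ * s - μ) * δ + 2 * s * ε := by
  have hδ0 : 0 ≤ δ := (Finset.sum_nonneg fun i _ => abs_nonneg _).trans hδ
  have hE : ∀ i, |∑ j ∈ Finset.univ.erase i, g i j * (w j - x j)| ≤
      μ * (∑ j, |w j - x j| - |w i - x i|) := fun i => abs_sum_erase_le (hg i)
  have hx0 : ∀ i, w i = 0 → x' i = 0 := by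
    intro i hi
    rw [hx' i]
    apply soft_eq_zero
    rw [hi, zero_add]
    refine (abs_add_le _ _).trans (add_le_add ((hE i).trans ?_) (he i))
    refine mul_le_mul_of_nonneg_left ?_ hμ
    have := abs_nonneg (w i - x i)
    linarith
  refine ⟨hx0, ?_⟩
  have hθ : 0 ≤ μ * δ + ε := by positivity
  have hF : ∀ i, |w i - x' i| ≤
      μ * (∑ j, |w j - x j| - |w i - x i|) + ((μ * δ + ε) + ε) := by
    intro i
    have h1 := abs_soft_sub_le hθ (w i + ∑ j ∈ Finset.univ.erase i, g i j * (w j - x j) + e i)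
    rw [← hx' i] at h1
    have h2 := hE i
    have h3 := he i
    rw [abs_le] at h1 h2 h3 ⊢
    constructor <;> linarith
  have := sum_support_le hs hw (fun i => abs_nonneg (w i - x i))
    (fun i hi => by simp [hi, hx i hi]) hμ (by positivity) hδ
    (fun i hi => by simp [hi, hx0 i hi]) hF
  refine this.trans (le_of_eq ?_)
  ring

/-! ### Correlations of the columns -/

/-- The cosine of two columns. -/
def cosine (A : Matrix (Fin m) (Fin N) ℝ) (i j : Fin N) : ℝ :=
  (∑ t, A t i * A t j) / (colNorm A i * colNorm A j)

lemma colNorm_nonneg (A : Matrix (Fin m) (Fin N) ℝ) (i : Fin N) : 0 ≤ colNorm A i :=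
  Real.sqrt_nonneg _

lemma colNorm_pos {A : Matrix (Fin m) (Fin N) ℝ} {i : Fin N} (h : ∃ t, A t i ≠ 0) :
    0 < colNorm A i := by
  obtain ⟨t, ht⟩ := h
  refine Real.sqrt_pos.2 (Finset.sum_pos' (fun _ _ => sq_nonneg _) ⟨t, Finset.mem_univ _, ?_⟩)
  positivity

lemma colNorm_sq (A : Matrix (Fin m) (Fin N) ℝ) (i : Fin N) :
    colNorm A i ^ 2 = ∑ t, A t i ^ 2 :=
  Real.sq_sqrt (Finset.sum_nonneg fun _ _ => sq_nonneg _)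

lemma abs_le_colNorm (A : Matrix (Fin m) (Fin N) ℝ) (t : Fin m) (i : Fin N) :
    |A t i| ≤ colNorm A i :=
  Real.abs_le_sqrt (Finset.single_le_sum (f := fun t => A t i ^ 2) (fun _ _ => sq_nonneg _)
    (Finset.mem_univ t))

lemma abs_cosine_le_coherence (A : Matrix (Fin m) (Fin N) ℝ) {i j : Fin N} (h : i ≠ j) :
    |cosine A i j| ≤ coherence A := by
  have := le_ciSup (f := fun q : {q : Fin N × Fin N // q.1 ≠ q.2} =>
    |∑ t, A t q.1.1 * A t q.1.2| / (colNorm A q.1.1 * colNorm A q.1.2))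
    (Set.finite_range _).bddAbove ⟨(i, j), h⟩
  refine le_trans (le_of_eq ?_) this
  rw [cosine, abs_div, abs_of_nonneg (mul_nonneg (colNorm_nonneg A i) (colNorm_nonneg A j))]

lemma cosine_self {A : Matrix (Fin m) (Fin N) ℝ} {i : Fin N} (h : 0 < colNorm A i) :
    cosine A i i = 1 := by
  rw [cosine, div_eq_one_iff_eq (by positivity), ← sq, colNorm_sq]
  simp [sq]

lemma sum_normalized_mul_mulVec {A : Matrix (Fin m) (Fin N) ℝ} (hA : ∀ i, 0 < colNorm A i)
    (v : Fin N → ℝ) (i : Fin N) :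
    ∑ t, A t i / colNorm A i * A.mulVec v t = ∑ j, cosine A i j * (colNorm A j * v j) := by
  simp only [Matrix.mulVec, dotProduct, Finset.mul_sum, cosine, Finset.sum_div, Finset.sum_mul]
  rw [Finset.sum_comm]
  refine Finset.sum_congr rfl fun j _ => Finset.sum_congr rfl fun t _ => ?_
  have := (hA i).ne'
  have := (hA j).ne'
  field_simp

lemma abs_sum_normalized_le {A : Matrix (Fin m) (Fin N) ℝ} {i : Fin N} (hA : 0 < colNorm A i)
    (z : Fin m → ℝ) : |∑ t, A t i / colNorm A i * z t| ≤ ∑ t, |z t| := by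
  refine (Finset.abs_sum_le_sum_abs _ _).trans (Finset.sum_le_sum fun t _ => ?_)
  rw [abs_mul, abs_div, abs_of_pos hA]
  refine mul_le_of_le_one_left (abs_nonneg _) ?_
  exact (div_le_one hA).2 (abs_le_colNorm A t i)

lemma hammingNorm_colNorm_mul {A : Matrix (Fin m) (Fin N) ℝ} (hA : ∀ i, 0 < colNorm A i)
    (w : Fin N → ℝ) : hammingNorm (fun i => colNorm A i * w i) = hammingNorm w := by
  unfold hammingNorm
  congr 1
  ext i
  simp [(hA i).ne']

/-- Sparse vectors are stably determined by their image: by diagonal dominance of the Gram matrix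
on at most `s` normalized columns. -/
lemma sum_colNorm_mul_le {A : Matrix (Fin m) (Fin N) ℝ} (hA : ∀ i, 0 < colNorm A i)
    (hμ : 0 ≤ coherence A) {s : ℕ} (hs : 1 ≤ s) (hq : 2 * coherence A * s - coherence A < 1)
    {w : Fin N → ℝ} (hw : hammingNorm w ≤ s) :
    ∑ i, colNorm A i * |w i| ≤ 2 * s * ∑ t, |A.mulVec w t| := by
  have hE : 0 ≤ ∑ t, |A.mulVec w t| := Finset.sum_nonneg fun _ _ => abs_nonneg _
  have habs : ∀ i, |colNorm A i * w i| = colNorm A i * |w i| := fun i => by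
    rw [abs_mul, abs_of_pos (hA i)]
  have hF : ∀ i, |colNorm A i * w i| ≤ coherence A *
      (∑ j, |colNorm A j * w j| - |colNorm A i * w i|) + ∑ t, |A.mulVec w t| := by
    intro i
    have h1 := sum_normalized_mul_mulVec hA w i
    rw [← Finset.add_sum_erase _ _ (Finset.mem_univ i), cosine_self (hA i), one_mul] at h1
    have h2 := abs_sum_normalized_le (hA i) (A.mulVec w)
    have h3 := abs_sum_erase_le (g := cosine A i) (D := fun j => colNorm A j * w j) (i := i)
      (fun j hj => abs_cosine_le_coherence A hj)
    have h4 : colNorm A i * w i = ∑ t, A t i / colNorm A i * A.mulVec w t -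
      ∑ j ∈ Finset.univ.erase i, cosine A i j * (colNorm A j * w j) := by linarith
    have h5 := abs_sub (∑ t, A t i / colNorm A i * A.mulVec w t)
      (∑ j ∈ Finset.univ.erase i, cosine A i j * (colNorm A j * w j))
    rw [← h4] at h5
    linarith
  have key := sum_support_le hs hw (fun i => abs_nonneg (colNorm A i * w i))
    (fun i hi => by simp [hi]) hμ hE le_rfl (fun i hi => by simp [hi]) hF
  simp only [habs] at key
  have hX : 0 ≤ ∑ i, colNorm A i * |w i| :=
    Finset.sum_nonneg fun i _ => mul_nonneg (hA i).le (abs_nonneg _)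
  have hhalf : coherence A * (s - 1) ≤ 1 / 2 := by nlinarith
  have := mul_le_mul_of_nonneg_right hhalf hX
  linarith

/-! ### The recovery network -/

/-- The matrix of one linear step on the pair `(y, x)`: it keeps `y` and maps `x` to
`x + Ãᵀ (y - Ã x)`, where `Ã` is `A` with normalized columns. -/
def stepMatrix (A : Matrix (Fin m) (Fin N) ℝ) : Matrix (Fin (m + N)) (Fin (m + N)) ℝ :=
  (Matrix.fromBlocks 1 0 (Matrix.of fun i t => A t i / colNorm A i)
    (1 - Matrix.of (cosine A))).submatrix finSumFinEquiv.symm finSumFinEquiv.symm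

/-- Thresholds that act only on the second component of `(y, x)`. -/
def stepThreshold (m N : ℕ) (θ : ℕ → ℝ) (t : ℕ) (a : Fin (m + N)) : ℝ :=
  Fin.addCases (fun _ => 0) (fun _ => θ t) a

/-- The linear map `(y, x) ↦ (x i / ‖a i‖)`, which undoes the normalization of the columns. -/
def readoutMatrix (A : Matrix (Fin m) (Fin N) ℝ) : Matrix (Fin N) (Fin (m + N)) ℝ :=
  Matrix.of fun i a => Fin.addCases (fun _ => 0) (fun j => if i = j then 1 / colNorm A i else 0) a

lemma stepMatrix_mulVec_castAdd (A : Matrix (Fin m) (Fin N) ℝ) (v : Fin (m + N) → ℝ)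
    (t : Fin m) : (stepMatrix A).mulVec v (Fin.castAdd N t) = v (Fin.castAdd N t) := by
  simp [stepMatrix, Matrix.mulVec, dotProduct, Fin.sum_univ_add, Matrix.one_apply]

lemma stepMatrix_mulVec_natAdd (A : Matrix (Fin m) (Fin N) ℝ) (v : Fin (m + N) → ℝ)
    (i : Fin N) : (stepMatrix A).mulVec v (Fin.natAdd m i) =
      ∑ t, A t i / colNorm A i * v (Fin.castAdd N t) + v (Fin.natAdd m i) -
        ∑ j, cosine A i j * v (Fin.natAdd m j) := by
  simp [stepMatrix, Matrix.mulVec, dotProduct, Fin.sum_univ_add, Matrix.one_apply, sub_mul,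
    Finset.sum_sub_distrib]
  ring

lemma readoutMatrix_mulVec (A : Matrix (Fin m) (Fin N) ℝ) (v : Fin (m + N) → ℝ) (i : Fin N) :
    (readoutMatrix A).mulVec v i = 1 / colNorm A i * v (Fin.natAdd m i) := by
  simp [readoutMatrix, Matrix.mulVec, dotProduct, Fin.sum_univ_add]

/-- The bound for the `ℓ₁` error after `t` contractions by `q` with additive noise `κ`. -/
def errBound (q κ δ₀ : ℝ) (t : ℕ) : ℝ := q ^ t * δ₀ + κ * ∑ i ∈ Finset.range t, q ^ i

lemma errBound_succ (q κ δ₀ : ℝ) (t : ℕ) :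
    errBound q κ δ₀ (t + 1) = q * errBound q κ δ₀ t + κ := by
  rw [errBound, errBound, geom_sum_succ]
  ring

/-- Soft thresholding iterations recover a sparse vector `w` from `y ≈ A w`, without false
positives. -/
lemma softIter_recovery {A : Matrix (Fin m) (Fin N) ℝ} (hA : ∀ i, 0 < colNorm A i)
    (hμ : 0 ≤ coherence A) {s : ℕ} (hs : 1 ≤ s) {δ₀ ε : ℝ} (hε : 0 ≤ ε)
    {y : Fin m → ℝ} {w : Fin N → ℝ} (hw : hammingNorm w ≤ s)
    (hy : ∑ t, |y t - A.mulVec w t| ≤ ε) (hδ₀ : ∑ i, colNorm A i * |w i| ≤ δ₀) {μ q : ℝ}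
    (hμ' : μ = coherence A) (hq : q = 2 * μ * s - μ) {θ : ℕ → ℝ}
    (hθ : ∀ t, θ t = μ * errBound q (2 * s * ε) δ₀ t + ε) {v : ℕ → Fin (m + N) → ℝ}
    (hv : v = softIter (stepMatrix A) (stepThreshold m N θ) (fun a => zeroExtend y a)) (t : ℕ) :
    (∀ r, v t (Fin.castAdd N r) = y r) ∧
    (∀ i, w i = 0 → v t (Fin.natAdd m i) = 0) ∧
    ∑ i, |colNorm A i * w i - v t (Fin.natAdd m i)| ≤ errBound q (2 * s * ε) δ₀ t := by
  induction t with
  | zero =>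
    have h0 : ∀ i, v 0 (Fin.natAdd m i) = 0 := fun i => by
      simp [hv, softIter, zeroExtend]
    refine ⟨fun r => by simp [hv, softIter, zeroExtend], fun i _ => h0 i, ?_⟩
    simpa [h0, errBound, abs_mul, abs_of_pos (hA _)] using hδ₀
  | succ t ih =>
    obtain ⟨ih1, ih2, ih3⟩ := ih
    have hstep : ∀ a, v (t + 1) a =
        soft (stepThreshold m N θ t a) ((stepMatrix A).mulVec (v t) a) := fun a => by
      rw [hv, softIter]
    refine ⟨fun r => ?_, ?_⟩
    · rw [hstep, stepMatrix_mulVec_castAdd, ih1, stepThreshold, Fin.addCases_left, soft_zero]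
    · have hw' : hammingNorm (fun i => colNorm A i * w i) ≤ s := by
        rwa [hammingNorm_colNorm_mul hA]
      have hz : ∀ i, colNorm A i * w i = 0 → w i = 0 := fun i hi =>
        (mul_eq_zero.1 hi).resolve_left (hA i).ne'
      have hx' : ∀ i, v (t + 1) (Fin.natAdd m i) =
          soft (μ * errBound q (2 * s * ε) δ₀ t + ε)
            (colNorm A i * w i + ∑ j ∈ Finset.univ.erase i,
                cosine A i j * (colNorm A j * w j - v t (Fin.natAdd m j)) +
              ∑ r, A r i / colNorm A i * (y r - A.mulVec w r)) := by
        intro i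
        rw [hstep, stepMatrix_mulVec_natAdd, stepThreshold, Fin.addCases_right, hθ]
        congr 1
        simp only [ih1, mul_sub, Finset.sum_sub_distrib]
        rw [sum_normalized_mul_mulVec hA,
          ← Finset.add_sum_erase _ (fun j => cosine A i j * (colNorm A j * w j))
            (Finset.mem_univ i),
          ← Finset.add_sum_erase _ (fun j => cosine A i j * v t (Fin.natAdd m j))
            (Finset.mem_univ i), cosine_self (hA i)]
        ring
      obtain ⟨h1, h2⟩ := soft_step hs (hμ'.symm ▸ hμ : 0 ≤ μ) hε
        (fun i j hij => hμ'.symm ▸ abs_cosine_le_coherence A hij)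
        hw' (fun i hi => ih2 i (hz i hi)) ih3
        (fun i => (abs_sum_normalized_le (hA i) _).trans hy) hx'
      refine ⟨fun i hi => h1 i (by simp [hi]), ?_⟩
      rw [errBound_succ]
      rw [hq] at h2 ⊢
      exact h2

/-- There is a convolutional network that recovers sparse vectors `w`, with at most `s` nonzero
entries and weighted `ℓ₁` norm at most `δ₀`, from data `y` with `‖y - A w‖₁ ≤ ε`. -/
theorem exists_recovery_cnn {k : ℕ} (hk : 1 < k) (hm : 1 ≤ m) {A : Matrix (Fin m) (Fin N) ℝ}
    (hA : ∀ i, 0 < colNorm A i) (hμ : 0 ≤ coherence A) {s : ℕ} (hs : 1 ≤ s) (J : ℕ) {δ₀ ε : ℝ}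
    (hε : 0 ≤ ε) :
    ∃ Φ : CNN k m N, Φ.depth = Nat.clog k (m + N) + J + 2 ∧
      Φ.numParams ≤ 2 * (m + N) + Nat.clog k (m + N) * (2 * (m + N)) +
        J * (2 * (m + N) * (2 * (m + N)) + 2 * (m + N)) + (N * (2 * (m + N)) + N) ∧
      ∀ (y : Fin m → ℝ) (w : Fin N → ℝ), hammingNorm w ≤ s →
        ∑ t, |y t - A.mulVec w t| ≤ ε → ∑ i, colNorm A i * |w i| ≤ δ₀ →
        hammingNorm (Φ.eval y) ≤ s ∧
        ∑ i, colNorm A i * |w i - Φ.eval y i| ≤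
          errBound (2 * coherence A * s - coherence A) (2 * s * ε) δ₀ J := by
  obtain ⟨Φ, h1, h2, h3⟩ := exists_cnn_softIter hk hm (Nat.le_add_right m N) (stepMatrix A)
    (readoutMatrix A) (stepThreshold m N fun t => coherence A *
      errBound (2 * coherence A * s - coherence A) (2 * s * ε) δ₀ t + ε) J
  refine ⟨Φ, h1, h2, fun y w hw hy hδ₀ => ?_⟩
  obtain ⟨-, h5, h6⟩ := softIter_recovery hA hμ hs hε hw hy hδ₀ rfl rfl (fun _ => rfl) rfl J
  constructor
  · refine le_trans (Finset.card_le_card fun i => ?_) hw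
    simp only [Finset.mem_filter, Finset.mem_univ, true_and]
    refine mt fun hi => ?_
    rw [h3, readoutMatrix_mulVec, h5 i hi, mul_zero]
  · refine le_trans (le_of_eq (Finset.sum_congr rfl fun i _ => ?_)) h6
    rw [h3, readoutMatrix_mulVec]
    conv_lhs => rw [← abs_of_pos (hA i), ← abs_mul, abs_of_pos (hA i)]
    congr 1
    have := (hA i).ne'
    field_simp

/-! ### Norms of vectors -/

lemma vecNorm_nonneg (p : ℝ) (z : Fin m → ℝ) : 0 ≤ vecNorm p z :=
  Real.rpow_nonneg (Finset.sum_nonneg fun _ _ => Real.rpow_nonneg (abs_nonneg _) _) _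

lemma empNorm_nonneg (p : ℝ) (z : Fin m → ℝ) : 0 ≤ empNorm p z :=
  Real.rpow_nonneg (mul_nonneg (by positivity)
    (Finset.sum_nonneg fun _ _ => Real.rpow_nonneg (abs_nonneg _) _)) _

lemma empNorm_eq (p : ℝ) (z : Fin m → ℝ) :
    empNorm p z = (m : ℝ) ^ (-(1 / p)) * vecNorm p z := by
  rw [empNorm, vecNorm, Real.mul_rpow (by positivity)
    (Finset.sum_nonneg fun _ _ => Real.rpow_nonneg (abs_nonneg _) _), one_div (m : ℝ),
    Real.inv_rpow (by positivity), Real.rpow_neg (by positivity)]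

lemma vecNorm_rpow {p : ℝ} (hp : 0 < p) (z : Fin m → ℝ) : vecNorm p z ^ p = ∑ i, |z i| ^ p := by
  rw [vecNorm, ← Real.rpow_mul (Finset.sum_nonneg fun _ _ => Real.rpow_nonneg (abs_nonneg _) _),
    one_div_mul_cancel hp.ne', Real.rpow_one]

lemma empNorm_rpow {p : ℝ} (hp : 0 < p) (z : Fin m → ℝ) :
    empNorm p z ^ p = 1 / (m : ℝ) * ∑ i, |z i| ^ p := by
  rw [empNorm, ← Real.rpow_mul (mul_nonneg (by positivity)
    (Finset.sum_nonneg fun _ _ => Real.rpow_nonneg (abs_nonneg _) _)),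
    one_div_mul_cancel hp.ne', Real.rpow_one]

lemma abs_le_vecNorm {p : ℝ} (hp : 0 < p) (z : Fin m → ℝ) (i : Fin m) : |z i| ≤ vecNorm p z := by
  rw [← Real.rpow_le_rpow_iff (abs_nonneg _) (vecNorm_nonneg _ _) hp, vecNorm_rpow hp]
  exact Finset.single_le_sum (f := fun i => |z i| ^ p)
    (fun _ _ => Real.rpow_nonneg (abs_nonneg _) _) (Finset.mem_univ i)

/-- The `ℓ_p` norms decrease in `p`. -/
lemma vecNorm_antitone {r p : ℝ} (hr : 0 < r) (hrp : r ≤ p) (z : Fin m → ℝ) :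
    vecNorm p z ≤ vecNorm r z := by
  have hp : 0 < p := hr.trans_le hrp
  have hX := vecNorm_nonneg r z
  rw [← Real.rpow_le_rpow_iff (vecNorm_nonneg _ _) hX hp, vecNorm_rpow hp]
  have hsplit : ∀ x : ℝ, 0 ≤ x → x ^ p = x ^ r * x ^ (p - r) := fun x hx => by
    rw [← Real.rpow_add_of_nonneg hx hr.le (by linarith)]
    congr 1
    ring
  rw [hsplit _ hX, vecNorm_rpow hr, Finset.sum_mul]
  refine Finset.sum_le_sum fun i _ => ?_
  rw [hsplit _ (abs_nonneg _)]
  exact mul_le_mul_of_nonneg_left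
    (Real.rpow_le_rpow (abs_nonneg _) (abs_le_vecNorm hr z i) (by linarith))
    (Real.rpow_nonneg (abs_nonneg _) _)

lemma vecNorm_one (z : Fin m → ℝ) : vecNorm 1 z = ∑ i, |z i| := by
  simp [vecNorm]

lemma vecNorm_two (z : Fin m → ℝ) : vecNorm 2 z = √(∑ i, z i ^ 2) := by
  simp [vecNorm, Real.sqrt_eq_rpow]

/-- The power mean inequality. -/
lemma empNorm_mono (hm : 1 ≤ m) {r p : ℝ} (hr : 0 < r) (hrp : r ≤ p) (z : Fin m → ℝ) :
    empNorm r z ≤ empNorm p z := by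
  have hp : 0 < p := hr.trans_le hrp
  have hm' : (m : ℝ) ≠ 0 := by positivity
  rw [← Real.rpow_le_rpow_iff (empNorm_nonneg _ _) (empNorm_nonneg _ _) hr, empNorm_rpow hr]
  have h := Real.arith_mean_le_rpow_mean Finset.univ (fun _ : Fin m => 1 / (m : ℝ))
    (fun i => |z i| ^ r) (fun _ _ => by positivity) (by simp [hm'])
    (fun _ _ => by positivity) ((one_le_div hr).2 hrp)
  rw [Finset.mul_sum]
  refine h.trans (le_of_eq ?_)
  rw [empNorm, ← Real.rpow_mul (mul_nonneg (by positivity)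
    (Finset.sum_nonneg fun _ _ => Real.rpow_nonneg (abs_nonneg _) _)), Finset.mul_sum]
  congr 1
  · refine Finset.sum_congr rfl fun i _ => ?_
    rw [← Real.rpow_mul (abs_nonneg _)]
    congr 2
    field_simp
  · field_simp

lemma empNorm_one (z : Fin m → ℝ) : empNorm 1 z = 1 / m * ∑ i, |z i| := by
  simp [empNorm]

lemma sum_abs_le (hm : 1 ≤ m) {p : ℝ} (hp : 1 ≤ p) (z : Fin m → ℝ) :
    ∑ i, |z i| ≤ m * empNorm p z := by
  have h := empNorm_mono hm one_pos hp z
  have hm' : (0 : ℝ) < m := by positivity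
  rw [empNorm_one, one_div, inv_mul_le_iff₀ hm'] at h
  exact h

lemma vecNorm_le_Cmp_mul (hm : 1 ≤ m) {p : ℝ} (hp : 1 ≤ p) (z : Fin m → ℝ) :
    vecNorm p z ≤ Cmp m p * vecNorm 2 z := by
  have hp0 : 0 < p := by linarith
  have hm' : (0 : ℝ) < m := by positivity
  rcases le_total 2 p with h | h
  · exact (vecNorm_antitone two_pos h z).trans
      (le_mul_of_one_le_left (vecNorm_nonneg _ _) (le_max_left _ _))
  · have h1 := empNorm_mono hm hp0 h z
    rw [empNorm_eq, empNorm_eq, Real.rpow_neg hm'.le,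
      inv_mul_le_iff₀ (Real.rpow_pos_of_pos hm' _), ← mul_assoc, ← Real.rpow_add hm'] at h1
    refine h1.trans (mul_le_mul_of_nonneg_right ?_ (vecNorm_nonneg _ _))
    exact le_max_right _ _

lemma empNorm_add_le {p : ℝ} (hp : 1 ≤ p) (x y : Fin m → ℝ) :
    empNorm p (fun i => x i + y i) ≤ empNorm p x + empNorm p y := by
  rw [empNorm_eq, empNorm_eq, empNorm_eq, ← mul_add]
  exact mul_le_mul_of_nonneg_left (Real.Lp_add_le Finset.univ x y hp) (by positivity)

lemma empNorm_neg (p : ℝ) (x : Fin m → ℝ) : empNorm p (fun i => -x i) = empNorm p x := by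
  simp [empNorm]

lemma empNorm_sub_le {p : ℝ} (hp : 1 ≤ p) (x y : Fin m → ℝ) :
    empNorm p (fun i => x i - y i) ≤ empNorm p x + empNorm p y := by
  simpa [sub_eq_add_neg, empNorm_neg] using empNorm_add_le hp x (fun i => -y i)

lemma empNorm_zero {p : ℝ} (hp : 0 < p) : empNorm p (0 : Fin m → ℝ) = 0 := by
  simp [empNorm, Real.zero_rpow hp.ne', Real.zero_rpow (inv_ne_zero hp.ne')]

lemma empNorm_mul {p : ℝ} (hp : 0 < p) (a : ℝ) (x : Fin m → ℝ) :
    empNorm p (fun i => a * x i) = |a| * empNorm p x := by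
  rw [← Real.rpow_left_inj (empNorm_nonneg _ _) (mul_nonneg (abs_nonneg _) (empNorm_nonneg _ _))
    hp.ne', Real.mul_rpow (abs_nonneg _) (empNorm_nonneg _ _), empNorm_rpow hp, empNorm_rpow hp]
  simp only [abs_mul, Real.mul_rpow (abs_nonneg _) (abs_nonneg _), ← Finset.mul_sum]
  ring

lemma empNorm_le_of_abs_le (hm : 1 ≤ m) {p B : ℝ} (hp : 0 < p) {z : Fin m → ℝ} (hB : 0 ≤ B)
    (hz : ∀ i, |z i| ≤ B) : empNorm p z ≤ B := by
  have hm' : (0 : ℝ) < m := by positivity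
  rw [← Real.rpow_le_rpow_iff (empNorm_nonneg _ _) hB hp, empNorm_rpow hp, one_div,
    inv_mul_le_iff₀ hm']
  refine (Finset.sum_le_card_nsmul _ _ (B ^ p) fun i _ =>
    Real.rpow_le_rpow (abs_nonneg _) (hz i) hp.le).trans (by simp)

lemma empNorm_mulVec_le (hm : 1 ≤ m) {p : ℝ} (hp : 1 ≤ p) (A : Matrix (Fin m) (Fin N) ℝ)
    (v : Fin N → ℝ) :
    empNorm p (A.mulVec v) ≤
      (m : ℝ) ^ (-(1 / p)) * Cmp m p * ∑ i, colNorm A i * |v i| := by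
  have hp0 : 0 < p := by linarith
  have hsum : A.mulVec v = ∑ i, fun t => v i * A t i := by
    funext t
    simp [Matrix.mulVec, dotProduct, mul_comm]
  rw [hsum, Finset.mul_sum]
  refine (Finset.le_sum_of_subadditive (empNorm p) (empNorm_zero hp0).le (empNorm_add_le hp)
    _ _).trans (Finset.sum_le_sum fun i _ => ?_)
  rw [empNorm_mul hp0, empNorm_eq]
  have h1 := vecNorm_le_Cmp_mul hm hp (fun t => A t i)
  rw [vecNorm_two] at h1
  change vecNorm p (fun t => A t i) ≤ Cmp m p * colNorm A i at h1
  calc |v i| * ((m : ℝ) ^ (-(1 / p)) * vecNorm p fun t => A t i)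
      ≤ |v i| * ((m : ℝ) ^ (-(1 / p)) * (Cmp m p * colNorm A i)) := by gcongr
    _ = _ := by ring

/-! ### Best sparse coefficients -/

lemma isClosed_hammingNorm_le (s : ℕ) : IsClosed {w : Fin N → ℝ | hammingNorm w ≤ s} := by
  have h : {w : Fin N → ℝ | hammingNorm w ≤ s} =
      ⋃ S ∈ {S : Finset (Fin N) | S.card ≤ s}, {w | ∀ i, i ∉ S → w i = 0} := by
    ext w
    simp only [Set.mem_ofPred_eq, Set.mem_iUnion, exists_prop]
    constructor
    · exact fun hw => ⟨Finset.univ.filter fun i => w i ≠ 0, hw, fun i hi => by simpa using hi⟩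
    · rintro ⟨S, hS, hw⟩
      refine le_trans (Finset.card_le_card fun i hi => ?_) hS
      by_contra hiS
      simp [hw i hiS] at hi
  rw [h]
  refine Set.Finite.isClosed_biUnion (Set.toFinite _) fun S _ => ?_
  simp only [Set.ofPred_forall]
  exact isClosed_iInter fun i => isClosed_iInter fun _ =>
    isClosed_eq (continuous_apply i) continuous_const

lemma continuous_empNorm {p : ℝ} (hp : 0 < p) : Continuous (empNorm p : (Fin m → ℝ) → ℝ) := by
  unfold empNorm
  refine Continuous.rpow_const ?_ fun _ => Or.inr (by positivity)
  refine continuous_const.mul (continuous_finsetSum _ fun i _ => ?_)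
  exact ((continuous_apply i).abs).rpow_const fun _ => Or.inr hp.le

/-- Best sparse coefficients exist, since on sparse vectors `w` the norm of `A w` is coercive. -/
lemma exists_isBestCoeff (hm : 1 ≤ m) {p : ℝ} (hp : 1 ≤ p) {A : Matrix (Fin m) (Fin N) ℝ}
    (hA : ∀ i, 0 < colNorm A i) (hμ : 0 ≤ coherence A) {s : ℕ} (hs : 1 ≤ s)
    (hq : 2 * coherence A * s - coherence A < 1) (y : Fin m → ℝ) :
    ∃ w, IsBestCoeff p s A y w := by
  have hp0 : 0 < p := by linarith
  set E := empNorm p y with hE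
  have hE0 : 0 ≤ E := empNorm_nonneg _ _
  set R : ℝ := 2 * s * (m * (2 * E)) with hR
  have hR0 : 0 ≤ R := by positivity
  set K : Set (Fin N → ℝ) := {w | hammingNorm w ≤ s} ∩
    Set.Icc (fun i => -(R / colNorm A i)) (fun i => R / colNorm A i) with hK
  have hKc : IsCompact K := isCompact_Icc.inter_left (isClosed_hammingNorm_le s)
  have h0K : (0 : Fin N → ℝ) ∈ K := by
    refine ⟨by simp, fun i => ?_, fun i => ?_⟩
    · simpa using div_nonneg hR0 (hA i).le
    · simpa using div_nonneg hR0 (hA i).le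
  have hcont : Continuous fun w : Fin N → ℝ => empNorm p (fun j => y j - A.mulVec w j) := by
    refine (continuous_empNorm hp0).comp (continuous_pi fun j => continuous_const.sub ?_)
    unfold Matrix.mulVec dotProduct
    fun_prop
  obtain ⟨w, hwK, hmin⟩ := hKc.exists_isMinOn ⟨0, h0K⟩ hcont.continuousOn
  refine ⟨w, hwK.1, fun v hv => ?_⟩
  by_cases hvK : v ∈ K
  · exact hmin hvK
  -- outside of `K` the error exceeds that of the zero vector
  · have h0 : empNorm p (fun j => y j - A.mulVec w j) ≤ E := by
      have := hmin h0K
      simpa [hE] using this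
    refine h0.trans ?_
    by_contra hlt
    push Not at hlt
    refine hvK ⟨hv, ?_⟩
    have h1 : empNorm p (A.mulVec v) ≤ 2 * E := by
      have h2 := empNorm_sub_le hp y (fun j => y j - A.mulVec v j)
      simp only [sub_sub_cancel] at h2
      linarith
    have h3 : ∑ i, colNorm A i * |v i| ≤ R := by
      refine (sum_colNorm_mul_le hA hμ hs hq hv).trans ?_
      exact mul_le_mul_of_nonneg_left ((sum_abs_le hm hp _).trans (by gcongr)) (by positivity)
    have h4 : ∀ i, |v i| ≤ R / colNorm A i := fun i => by
      rw [le_div_iff₀ (hA i), mul_comm]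
      exact (Finset.single_le_sum (f := fun i => colNorm A i * |v i|)
        (fun i _ => mul_nonneg (hA i).le (abs_nonneg _)) (Finset.mem_univ i)).trans h3
    exact ⟨fun i => (abs_le.1 (h4 i)).1, fun i => (abs_le.1 (h4 i)).2⟩

/-! ### Norms of continuous functions -/

lemma LNorm_nonneg {Ω : Type*} [TopologicalSpace Ω] [MeasurableSpace Ω] (q : ℝ≥0∞)
    (ρ : Measure Ω) (f : C(Ω, ℝ)) : 0 ≤ LNorm q ρ f :=
  ENNReal.toReal_nonneg

lemma LNorm_le_norm {Ω : Type*} [TopologicalSpace Ω] [CompactSpace Ω] [MeasurableSpace Ω]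
    (q : ℝ≥0∞) (ρ : Measure Ω) [IsProbabilityMeasure ρ] (f : C(Ω, ℝ)) :
    LNorm q ρ f ≤ ‖f‖ := by
  refine ENNReal.toReal_le_of_le_ofReal (norm_nonneg _) ?_
  simpa using eLpNorm_le_of_ae_bound (p := q) (μ := ρ)
    (Filter.Eventually.of_forall f.norm_coe_le_norm)

lemma isProbabilityMeasure_mixedMeasure {Ω : Type*} [MeasurableSpace Ω] (hm : 1 ≤ m)
    (ν : Measure Ω) [IsProbabilityMeasure ν]
    (ξ : Fin m → Ω) : IsProbabilityMeasure (mixedMeasure ν ξ) := by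
  constructor
  have hm' : (m : ℝ≥0∞) ≠ 0 := by
    have : m ≠ 0 := by omega
    exact_mod_cast this
  simp only [mixedMeasure, Measure.add_apply, Measure.smul_apply, measure_univ, smul_eq_mul,
    mul_one, Measure.finsetSum_apply, Finset.sum_const, Finset.card_univ, Fintype.card_fin,
    nsmul_eq_mul]
  rw [ENNReal.mul_inv (Or.inl (by simp)) (Or.inl (by simp)), mul_assoc,
    ENNReal.inv_mul_cancel hm' (ENNReal.natCast_ne_top m), mul_one, ENNReal.inv_two_add_inv_two]

section Functions

variable {Ω : Type*} [TopologicalSpace Ω] [CompactSpace Ω] [MeasurableSpace Ω] [BorelSpace Ω]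

lemma memLp_continuousMap (q : ℝ≥0∞) (ρ : Measure Ω) [IsFiniteMeasure ρ] (f : C(Ω, ℝ)) :
    MemLp f q ρ :=
  MemLp.of_bound f.continuous.measurable.aestronglyMeasurable ‖f‖
    (Filter.Eventually.of_forall f.norm_coe_le_norm)

lemma LNorm_rpow {p : ℝ} (hp : 0 < p) (ρ : Measure Ω) [IsFiniteMeasure ρ] (f : C(Ω, ℝ)) :
    LNorm (ENNReal.ofReal p) ρ f ^ p = ∫ x, |f x| ^ p ∂ρ := by
  have hI : 0 ≤ ∫ x, |f x| ^ p ∂ρ := integral_nonneg fun x => by positivity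
  rw [LNorm, (memLp_continuousMap _ ρ f).eLpNorm_eq_integral_rpow_norm
    (by simpa using hp) ENNReal.ofReal_ne_top, ENNReal.toReal_ofReal hp.le]
  simp only [Real.norm_eq_abs]
  rw [ENNReal.toReal_ofReal (by positivity), ← Real.rpow_mul hI, inv_mul_cancel₀ hp.ne',
    Real.rpow_one]

lemma LNorm_add_le {q : ℝ≥0∞} (hq : 1 ≤ q) (ρ : Measure Ω) [IsFiniteMeasure ρ]
    (f g : C(Ω, ℝ)) : LNorm q ρ (f + g) ≤ LNorm q ρ f + LNorm q ρ g := by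
  have hf := memLp_continuousMap q ρ f
  have hg := memLp_continuousMap q ρ g
  unfold LNorm
  rw [← ENNReal.toReal_add hf.eLpNorm_ne_top hg.eLpNorm_ne_top]
  refine ENNReal.toReal_mono (ENNReal.add_ne_top.2 ⟨hf.eLpNorm_ne_top, hg.eLpNorm_ne_top⟩) ?_
  exact eLpNorm_add_le hf.1 hg.1 hq

lemma integrable_abs_rpow {p : ℝ} (hp : 0 ≤ p) (ρ : Measure Ω) [IsFiniteMeasure ρ]
    (f : C(Ω, ℝ)) : Integrable (fun x => |f x| ^ p) ρ := by
  have hc : Continuous fun x => |f x| ^ p :=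
    f.continuous.abs.rpow_const fun _ => Or.inr hp
  exact (memLp_continuousMap 1 ρ ⟨_, hc⟩).integrable le_rfl

lemma LNorm_mixedMeasure_rpow (hm : 1 ≤ m) {p : ℝ} (hp : 0 < p) (ν : Measure Ω)
    [IsProbabilityMeasure ν] (ξ : Fin m → Ω) (f : C(Ω, ℝ)) :
    LNorm (ENNReal.ofReal p) (mixedMeasure ν ξ) f ^ p =
      (LNorm (ENNReal.ofReal p) ν f ^ p + empNorm p (sample ξ f) ^ p) / 2 := by
  have := isProbabilityMeasure_mixedMeasure hm ν ξ
  have hm' : (m : ℝ) ≠ 0 := by positivity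
  have hmt : (2 * (m : ℝ≥0∞))⁻¹ ≠ ∞ := by
    simp; omega
  have hint : ∀ ρ : Measure Ω, IsFiniteMeasure ρ → Integrable (fun x => |f x| ^ p) ρ :=
    fun ρ _ => integrable_abs_rpow hp.le ρ f
  have hsm : StronglyMeasurable fun x => |f x| ^ p :=
    (f.continuous.abs.rpow_const fun _ => Or.inr hp.le).stronglyMeasurable
  rw [LNorm_rpow hp, LNorm_rpow hp, empNorm_rpow hp, mixedMeasure, integral_add_measure
    ((hint _ inferInstance).smul_measure (by simp))
    ((hint _ inferInstance).smul_measure hmt), integral_smul_measure, integral_smul_measure,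
    integral_finsetSum_measure fun j _ => hint _ inferInstance]
  simp only [integral_dirac' _ _ hsm, sample, ENNReal.toReal_inv, ENNReal.toReal_mul,
    ENNReal.toReal_ofNat, ENNReal.toReal_natCast, smul_eq_mul]
  field_simp

lemma le_two_rpow_mul {p a b : ℝ} (hp : 0 < p) (ha : 0 ≤ a) (hb : 0 ≤ b)
    (h : a ^ p ≤ 2 * b ^ p) : a ≤ 2 ^ (1 / p) * b := by
  rw [← Real.rpow_le_rpow_iff ha (by positivity) hp, Real.mul_rpow (by positivity) hb,
    ← Real.rpow_mul (by norm_num), one_div_mul_cancel hp.ne', Real.rpow_one]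
  exact h

lemma LNorm_le_mixed (hm : 1 ≤ m) {p : ℝ} (hp : 0 < p) (ν : Measure Ω)
    [IsProbabilityMeasure ν] (ξ : Fin m → Ω) (f : C(Ω, ℝ)) :
    LNorm (ENNReal.ofReal p) ν f ≤
      2 ^ (1 / p) * LNorm (ENNReal.ofReal p) (mixedMeasure ν ξ) f := by
  refine le_two_rpow_mul hp (LNorm_nonneg _ _ _) (LNorm_nonneg _ _ _) ?_
  rw [LNorm_mixedMeasure_rpow hm hp]
  have := Real.rpow_nonneg (empNorm_nonneg p (sample ξ f)) p
  linarith

lemma empNorm_sample_le_mixed (hm : 1 ≤ m) {p : ℝ} (hp : 0 < p) (ν : Measure Ω)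
    [IsProbabilityMeasure ν] (ξ : Fin m → Ω) (f : C(Ω, ℝ)) :
    empNorm p (sample ξ f) ≤
      2 ^ (1 / p) * LNorm (ENNReal.ofReal p) (mixedMeasure ν ξ) f := by
  refine le_two_rpow_mul hp (empNorm_nonneg _ _) (LNorm_nonneg _ _ _) ?_
  rw [LNorm_mixedMeasure_rpow hm hp]
  have := Real.rpow_nonneg (LNorm_nonneg (ENNReal.ofReal p) ν f) p
  linarith

lemma ae_abs_le_LNorm_top (ν : Measure Ω) [IsProbabilityMeasure ν] (f : C(Ω, ℝ)) :
    ∀ᵐ x ∂ν, |f x| ≤ LNorm ∞ ν f := by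
  filter_upwards [ae_le_eLpNormEssSup (f := f) (μ := ν)] with x hx
  rw [← eLpNorm_exponent_top] at hx
  have := ENNReal.toReal_mono (memLp_continuousMap ∞ ν f).eLpNorm_ne_top hx
  simpa [LNorm] using this

lemma abs_le_LNorm_top_of_mem_support (ν : Measure Ω) [IsProbabilityMeasure ν] (f : C(Ω, ℝ))
    {x : Ω} (hx : x ∈ ν.support) : |f x| ≤ LNorm ∞ ν f := by
  by_contra hlt
  push Not at hlt
  have hopen : IsOpen {y | LNorm ∞ ν f < |f y|} := isOpen_lt continuous_const f.continuous.abs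
  have hpos := (Measure.mem_support_iff_forall x).1 hx _ (hopen.mem_nhds hlt)
  have h0 := ae_iff.1 (ae_abs_le_LNorm_top ν f)
  simp only [not_le] at h0
  exact hpos.ne' h0

lemma LNorm_mixed_le_top (hm : 1 ≤ m) {p : ℝ} (hp : 0 < p) (ν : Measure Ω)
    [IsProbabilityMeasure ν] {ξ : Fin m → Ω} (hξ : ∀ j, ξ j ∈ ν.support) (f : C(Ω, ℝ)) :
    LNorm (ENNReal.ofReal p) (mixedMeasure ν ξ) f ≤ LNorm ∞ ν f := by
  have h0 := LNorm_nonneg ∞ ν f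
  rw [← Real.rpow_le_rpow_iff (LNorm_nonneg _ _ _) h0 hp, LNorm_mixedMeasure_rpow hm hp]
  have h1 : LNorm (ENNReal.ofReal p) ν f ^ p ≤ LNorm ∞ ν f ^ p := by
    rw [LNorm_rpow hp]
    calc ∫ x, |f x| ^ p ∂ν ≤ ∫ _, LNorm ∞ ν f ^ p ∂ν := by
          refine integral_mono_ae (integrable_abs_rpow hp.le ν f) (integrable_const _) ?_
          filter_upwards [ae_abs_le_LNorm_top ν f] with x hx
          exact Real.rpow_le_rpow (abs_nonneg _) hx hp.le
      _ = _ := by simp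
  have h2 : empNorm p (sample ξ f) ^ p ≤ LNorm ∞ ν f ^ p :=
    Real.rpow_le_rpow (empNorm_nonneg _ _) (empNorm_le_of_abs_le hm hp h0
      fun j => abs_le_LNorm_top_of_mem_support ν f (hξ j)) hp.le
  linarith

end Functions

/-! ### Errors of best sparse approximation -/

lemma zero_mem_sparseSet {Ω : Type*} [TopologicalSpace Ω] (u : Fin N → C(Ω, ℝ)) (s : ℕ) :
    0 ∈ sparseSet u s :=
  ⟨0, by simp, by simp [combo]⟩

lemma combo_sub {Ω : Type*} [TopologicalSpace Ω] (u : Fin N → C(Ω, ℝ)) (v w : Fin N → ℝ) :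
    combo u (v - w) = combo u v - combo u w := by
  simp [combo, sub_smul]

lemma sample_combo {Ω : Type*} [TopologicalSpace Ω] (ξ : Fin m → Ω) (u : Fin N → C(Ω, ℝ))
    (w : Fin N → ℝ) : sample ξ (combo u w) = (dictMatrix ξ u).mulVec w := by
  funext j
  simp [sample, combo, dictMatrix, Matrix.mulVec, dotProduct, mul_comm]

lemma combo_sub_mem_sparseSet {Ω : Type*} [TopologicalSpace Ω] (u : Fin N → C(Ω, ℝ)) {s : ℕ}
    {v w : Fin N → ℝ} (hv : hammingNorm v ≤ s) (hw : hammingNorm w ≤ s) :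
    combo u v - combo u w ∈ sparseSet u (2 * s) := by
  refine ⟨v - w, ?_, (combo_sub u v w).symm⟩
  have h := hammingDist_triangle v 0 w
  rw [hammingDist_zero_right, hammingDist_zero_left] at h
  rw [sub_eq_neg_add, ← hammingDist_eq_hammingNorm, hammingDist_comm]
  omega

section Errors

variable {Ω : Type*} [TopologicalSpace Ω] [MeasurableSpace Ω] (u : Fin N → C(Ω, ℝ)) (s : ℕ)

lemma bestErr_le (q : ℝ≥0∞) (ρ : Measure Ω) (f : C(Ω, ℝ)) {g : C(Ω, ℝ)}
    (hg : g ∈ sparseSet u s) : bestErr u s q ρ f ≤ LNorm q ρ (f - g) :=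
  csInf_le ⟨0, by rintro _ ⟨g, -, rfl⟩; exact LNorm_nonneg _ _ _⟩ ⟨g, hg, rfl⟩

lemma le_bestErr {q : ℝ≥0∞} {ρ : Measure Ω} {f : C(Ω, ℝ)} {a : ℝ}
    (h : ∀ g ∈ sparseSet u s, a ≤ LNorm q ρ (f - g)) : a ≤ bestErr u s q ρ f := by
  refine le_csInf ⟨_, 0, zero_mem_sparseSet u s, rfl⟩ ?_
  rintro _ ⟨g, hg, rfl⟩
  exact h g hg

lemma worstErr_nonneg (q : ℝ≥0∞) (ρ : Measure Ω) (F : Set C(Ω, ℝ)) :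
    0 ≤ worstErr u s q ρ F := by
  refine Real.sSup_nonneg ?_
  rintro _ ⟨f, -, rfl⟩
  exact le_bestErr u s fun g _ => LNorm_nonneg _ _ _

variable [CompactSpace Ω]

lemma bestErr_le_worstErr (q : ℝ≥0∞) (ρ : Measure Ω) [IsProbabilityMeasure ρ] {B : ℝ}
    {f : C(Ω, ℝ)} (hf : ‖f‖ ≤ B) :
    bestErr u s q ρ f ≤ worstErr u s q ρ {f : C(Ω, ℝ) | ‖f‖ ≤ B} := by
  refine le_csSup ⟨B, ?_⟩ ⟨f, hf, rfl⟩
  rintro _ ⟨g, hg, rfl⟩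
  refine (bestErr_le u s q ρ g (zero_mem_sparseSet u s)).trans ?_
  rw [sub_zero]
  exact (LNorm_le_norm q ρ g).trans hg

/-- A bound by a multiple of every approximation error is a bound by that multiple of the
worst-case best error. -/
lemma le_mul_worstErr {q : ℝ≥0∞} {ρ : Measure Ω} [IsProbabilityMeasure ρ] {B a K : ℝ}
    {f : C(Ω, ℝ)} (hf : ‖f‖ ≤ B) (hK : 0 < K)
    (h : ∀ g ∈ sparseSet u s, a ≤ K * LNorm q ρ (f - g)) :
    a ≤ K * worstErr u s q ρ {f : C(Ω, ℝ) | ‖f‖ ≤ B} := by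
  rw [← div_le_iff₀' hK]
  refine le_trans (le_bestErr u s fun g hg => ?_) (bestErr_le_worstErr u s q ρ hf)
  rw [div_le_iff₀' hK]
  exact h g hg

lemma worstErr_mixed_le_top [BorelSpace Ω] (hm : 1 ≤ m) {p B : ℝ} (hp : 0 < p) (hB : 0 ≤ B)
    (ν : Measure Ω) [IsProbabilityMeasure ν] {ξ : Fin m → Ω} (hξ : ∀ j, ξ j ∈ ν.support) :
    worstErr u s (ENNReal.ofReal p) (mixedMeasure ν ξ) {f : C(Ω, ℝ) | ‖f‖ ≤ B} ≤
      worstErr u s ∞ ν {f : C(Ω, ℝ) | ‖f‖ ≤ B} := by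
  refine csSup_le ⟨_, 0, by simpa using hB, rfl⟩ ?_
  rintro _ ⟨f, hf, rfl⟩
  refine le_trans (le_bestErr u s fun g hg => ?_) (bestErr_le_worstErr u s ∞ ν hf)
  exact (bestErr_le u s _ _ f hg).trans (LNorm_mixed_le_top hm hp ν hξ _)

end Errors

lemma OneSidedUD.LNorm_le {Ω : Type*} [TopologicalSpace Ω] [MeasurableSpace Ω] {ν : Measure Ω}
    {ξ : Fin m → Ω} {u : Fin N → C(Ω, ℝ)} {s : ℕ} {p C₁ : ℝ} (h : OneSidedUD ν ξ u s p C₁) (hp : 0 < p) {g : C(Ω, ℝ)}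
    (hg : g ∈ sparseSet u (2 * s)) :
    LNorm (ENNReal.ofReal p) ν g ≤ C₁ ^ (-(1 / p)) * empNorm p (sample ξ g) := by
  obtain ⟨hC, h⟩ := h
  rw [← Real.rpow_le_rpow_iff (LNorm_nonneg _ _ _)
    (mul_nonneg (Real.rpow_nonneg hC.le _) (empNorm_nonneg _ _)) hp,
    Real.mul_rpow (Real.rpow_nonneg hC.le _) (empNorm_nonneg _ _), ← Real.rpow_mul hC.le,
    empNorm_rpow hp, neg_mul, one_div_mul_cancel hp.ne', Real.rpow_neg_one,
    le_inv_mul_iff₀ hC]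
  exact h g hg

lemma empNorm_residual_le {Ω : Type*} [TopologicalSpace Ω] {ξ : Fin m → Ω}
    {u : Fin N → C(Ω, ℝ)} {s : ℕ} {p : ℝ} {f : C(Ω, ℝ)} {w : Fin N → ℝ}
    (hw : IsBestCoeff p s (dictMatrix ξ u) (sample ξ f) w)
    {v : Fin N → ℝ} (hv : hammingNorm v ≤ s) :
    empNorm p (sample ξ (f - combo u w)) ≤ empNorm p (sample ξ (f - combo u v)) := by
  have h : ∀ v, sample ξ (f - combo u v) =
      fun j => sample ξ f j - (dictMatrix ξ u).mulVec v j := fun v => by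
    rw [← sample_combo]
    rfl
  rw [h, h]
  exact hw.2 v hv

section Approximation

variable {Ω : Type*} [TopologicalSpace Ω] [CompactSpace Ω] [MeasurableSpace Ω] [BorelSpace Ω]
  {ν : Measure Ω} [IsProbabilityMeasure ν] {ξ : Fin m → Ω} {u : Fin N → C(Ω, ℝ)} {s : ℕ}
  {p B C₁ : ℝ} {f : C(Ω, ℝ)} {w : Fin N → ℝ}

lemma empNorm_residual_le_worstErr (hm : 1 ≤ m) (hp : 0 < p) (hf : ‖f‖ ≤ B)
    (hw : IsBestCoeff p s (dictMatrix ξ u) (sample ξ f) w) :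
    empNorm p (sample ξ (f - combo u w)) ≤ 2 ^ (1 / p) *
      worstErr u s (ENNReal.ofReal p) (mixedMeasure ν ξ) {f : C(Ω, ℝ) | ‖f‖ ≤ B} := by
  have := isProbabilityMeasure_mixedMeasure hm ν ξ
  refine le_mul_worstErr u s hf (by positivity) ?_
  rintro _ ⟨v, hv, rfl⟩
  exact (empNorm_residual_le hw hv).trans (empNorm_sample_le_mixed hm hp ν ξ _)

/-- The error of the best coefficients in the continuous norm: compare with any sparse
combination, on which the norm is controlled by the samples. -/
lemma LNorm_residual_le_worstErr (hm : 1 ≤ m) (hp : 1 ≤ p) (hf : ‖f‖ ≤ B)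
    (hUD : OneSidedUD ν ξ u s p C₁)
    (hw : IsBestCoeff p s (dictMatrix ξ u) (sample ξ f) w) :
    LNorm (ENNReal.ofReal p) ν (f - combo u w) ≤ C3 p C₁ *
      worstErr u s (ENNReal.ofReal p) (mixedMeasure ν ξ) {f : C(Ω, ℝ) | ‖f‖ ≤ B} := by
  have := isProbabilityMeasure_mixedMeasure hm ν ξ
  have hp0 : 0 < p := by linarith
  have hC := hUD.1
  have hq : 1 ≤ ENNReal.ofReal p := by simpa using hp
  set D : ℝ := C₁ ^ (-(1 / p)) with hD
  have hD0 : 0 < D := Real.rpow_pos_of_pos hC _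
  have hC3 : 2 ^ (1 / p) * (1 + 2 * D) ≤ C3 p C₁ := by
    have h2 : (0 : ℝ) < 2 ^ (1 / p) := by positivity
    have hE : (0 : ℝ) < (1 + C₁⁻¹) ^ (1 / p) := by positivity
    rw [C3, ← hD]
    have h3 := mul_pos h2 hE
    have h4 := mul_pos (mul_pos h2 hD0) hE
    nlinarith
  refine le_trans (le_mul_worstErr u s (K := 2 ^ (1 / p) * (1 + 2 * D)) hf (by positivity) ?_)
    (mul_le_mul_of_nonneg_right hC3 (worstErr_nonneg _ _ _ _ _))
  rintro _ ⟨v, hv, rfl⟩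
  have h1 := LNorm_add_le hq ν (f - combo u v) (combo u v - combo u w)
  rw [sub_add_sub_cancel] at h1
  have h2 := hUD.LNorm_le hp0 (combo_sub_mem_sparseSet u hv hw.1)
  have h3 : empNorm p (sample ξ (combo u v - combo u w)) ≤
      empNorm p (sample ξ (f - combo u w)) + empNorm p (sample ξ (f - combo u v)) := by
    refine le_trans (le_of_eq ?_) (empNorm_sub_le hp _ _)
    congr 1
    funext j
    simp [sample]
  have h4 := empNorm_residual_le hw hv
  have h5 := empNorm_sample_le_mixed hm hp0 ν ξ (f - combo u v)
  have h6 := LNorm_le_mixed hm hp0 ν ξ (f - combo u v)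
  have h7 : empNorm p (sample ξ (combo u v - combo u w)) ≤
      2 * (2 ^ (1 / p) * LNorm (ENNReal.ofReal p) (mixedMeasure ν ξ) (f - combo u v)) := by
    linarith
  have h8 := mul_le_mul_of_nonneg_left h7 hD0.le
  linarith

end Approximation

/-! ### Size of the network and error of its output -/

lemma clog_le_max_logb_add_one {k M : ℕ} (hM : 1 ≤ M) (hk : 1 < k) :
    (Nat.clog k M : ℝ) ≤ max 1 (Real.logb k M) + 1 := by
  have h0 : 0 ≤ Real.logb k M :=
    Real.logb_nonneg (by exact_mod_cast hk) (by exact_mod_cast hM)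
  rw [← Real.natCeil_logb_natCast]
  have := Nat.ceil_lt_add_one h0
  have := le_max_right 1 (Real.logb k M)
  linarith

lemma numParams_bound_le {k m N J : ℕ} (hk : 1 < k) (hm : 1 ≤ m) (hJ : 1 ≤ J) :
    2 * (m + N) + Nat.clog k (m + N) * (2 * (m + N)) +
        J * (2 * (m + N) * (2 * (m + N)) + 2 * (m + N)) + (N * (2 * (m + N)) + N) ≤
      13 * (J * (m + N) ^ 2) := by
  have hN : N ≤ m + N := Nat.le_add_left _ _
  generalize hMdef : m + N = M at *
  have hM : 1 ≤ M := by omega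
  have hc : Nat.clog k M ≤ M := Nat.clog_le_of_le_pow (Nat.lt_pow_self hk).le
  have h1 : M ≤ M ^ 2 := by nlinarith
  have h2 : M ^ 2 ≤ J * M ^ 2 := Nat.le_mul_of_pos_left _ (by omega)
  have h3 : Nat.clog k M * (2 * M) ≤ M * (2 * M) := Nat.mul_le_mul_right _ hc
  have h4 : N * (2 * M) ≤ M * (2 * M) := Nat.mul_le_mul_right _ hN
  have h5 : J * M ≤ J * M ^ 2 := Nat.mul_le_mul_left _ h1
  have h6 : J * (2 * M * (2 * M) + 2 * M) = 4 * (J * M ^ 2) + 2 * (J * M) := by ring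
  have h7 : M * (2 * M) = 2 * M ^ 2 := by ring
  omega

lemma le_c0 (A : Matrix (Fin m) (Fin N) ℝ) (i : Fin N) : 1 / colNorm A i ≤ c0 A :=
  le_ciSup (f := fun i => 1 / colNorm A i) (Set.finite_range _).bddAbove i

lemma c0_nonneg (A : Matrix (Fin m) (Fin N) ℝ) : 0 ≤ c0 A :=
  Real.iSup_nonneg fun _ => div_nonneg zero_le_one (colNorm_nonneg _ _)

lemma vecNorm_le_c0_mul {p : ℝ} (hp : 1 ≤ p) {A : Matrix (Fin m) (Fin N) ℝ}
    (hA : ∀ i, 0 < colNorm A i) (z : Fin N → ℝ) :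
    vecNorm p z ≤ c0 A * ∑ i, colNorm A i * |z i| := by
  refine (vecNorm_antitone one_pos hp z).trans ?_
  rw [vecNorm_one, Finset.mul_sum]
  refine Finset.sum_le_sum fun i _ => ?_
  have h := mul_le_mul_of_nonneg_right (le_c0 A i) (mul_nonneg (hA i).le (abs_nonneg (z i)))
  refine le_trans (le_of_eq ?_) h
  have := (hA i).ne'
  field_simp

lemma ratio_pos {A : Matrix (Fin m) (Fin N) ℝ} {s : ℕ} (hs : 1 ≤ s) (hμ : 0 < coherence A) :
    0 < 2 * coherence A * s - coherence A := by
  have : (1 : ℝ) ≤ s := by exact_mod_cast hs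
  nlinarith

lemma ratio_lt_one {A : Matrix (Fin m) (Fin N) ℝ} {s : ℕ} (hμ : 0 < coherence A)
    (h : (s : ℝ) < sBar A) : 2 * coherence A * s - coherence A < 1 := by
  rw [sBar] at h
  have h1 := mul_lt_mul_of_pos_left h (mul_pos two_pos hμ)
  have h2 : 2 * coherence A * ((1 + 1 / coherence A) / 2) = coherence A + 1 := by
    field_simp
  linarith

lemma exp_neg_C5 {A : Matrix (Fin m) (Fin N) ℝ} {s : ℕ}
    (hq : 0 < 2 * coherence A * s - coherence A) (J : ℕ) :
    Real.exp (-C5 A s * J) = (2 * coherence A * s - coherence A) ^ J := by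
  rw [C5, neg_neg, mul_comm, Real.exp_nat_mul, Real.exp_log hq]

lemma geomConst_nonneg {A : Matrix (Fin m) (Fin N) ℝ} {s : ℕ}
    (hq : 0 < 2 * coherence A * s - coherence A) (J : ℕ) : 0 ≤ geomConst A s J :=
  mul_nonneg (by positivity) (Finset.sum_nonneg fun _ _ => pow_nonneg hq.le _)

lemma errBound_le_geomConst {A : Matrix (Fin m) (Fin N) ℝ} {s : ℕ}
    (hq : 0 < 2 * coherence A * s - coherence A) (J : ℕ) {ε : ℝ} (hε : 0 ≤ ε) (δ₀ : ℝ) :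
    errBound (2 * coherence A * s - coherence A) (2 * s * ε) δ₀ J ≤
      (2 * coherence A * s - coherence A) ^ J * δ₀ + geomConst A s J * ε := by
  rw [errBound, geomConst, Finset.sum_range_succ]
  have h1 : 0 ≤ 2 * s * (2 * coherence A * s - coherence A) ^ J * ε := by positivity
  linarith

/-- The best coefficients of a function bounded by `B` are bounded: their residual is at most that
of the zero vector. -/
lemma sum_colNorm_bestCoeff_le {Ω : Type*} [TopologicalSpace Ω] [CompactSpace Ω] {ξ : Fin m → Ω}
    {u : Fin N → C(Ω, ℝ)} {s : ℕ} {p B : ℝ} {f : C(Ω, ℝ)} {w : Fin N → ℝ} (hm : 1 ≤ m) (hp : 1 ≤ p)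
    (hA : ∀ i, 0 < colNorm (dictMatrix ξ u) i) (hμ : 0 ≤ coherence (dictMatrix ξ u))
    (hs : 1 ≤ s) (hq : 2 * coherence (dictMatrix ξ u) * s - coherence (dictMatrix ξ u) < 1)
    (hf : ‖f‖ ≤ B) (hw : IsBestCoeff p s (dictMatrix ξ u) (sample ξ f) w) :
    ∑ i, colNorm (dictMatrix ξ u) i * |w i| ≤ 4 * B * m * s := by
  have hp0 : 0 < p := by linarith
  have hB : 0 ≤ B := (norm_nonneg f).trans hf
  have h1 : empNorm p (sample ξ f) ≤ B :=
    empNorm_le_of_abs_le hm hp0 hB fun j => (f.norm_coe_le_norm (ξ j)).trans hf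
  have h2 : empNorm p (fun j => sample ξ f j - (dictMatrix ξ u).mulVec w j) ≤ B := by
    refine (hw.2 0 (by simp)).trans ?_
    simpa using h1
  have h3 := empNorm_sub_le hp (sample ξ f)
    (fun j => sample ξ f j - (dictMatrix ξ u).mulVec w j)
  simp only [sub_sub_cancel] at h3
  have h4 : ∑ t, |(dictMatrix ξ u).mulVec w t| ≤ m * (2 * B) :=
    (sum_abs_le hm hp _).trans (mul_le_mul_of_nonneg_left (h3.trans (by linarith))
      (by positivity))
  refine (sum_colNorm_mul_le hA hμ hs hq hw.1).trans ?_
  refine (mul_le_mul_of_nonneg_left h4 (by positivity)).trans (le_of_eq ?_)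
  ring

lemma mul_rpow_neg_one_div (hm : 1 ≤ m) (p : ℝ) :
    (m : ℝ) ^ (-(1 / p)) * m = (m : ℝ) ^ (1 - 1 / p) := by
  have hm' : (0 : ℝ) < m := by positivity
  rw [sub_eq_neg_add, Real.rpow_add hm', Real.rpow_one]

lemma Cmp_pos (m : ℕ) (p : ℝ) : 0 < Cmp m p := lt_max_of_lt_left one_pos

lemma C3_nonneg {p C₁ : ℝ} (hC : 0 < C₁) : 0 ≤ C3 p C₁ := by
  unfold C3
  positivity

end

end SparseCNN

theorem theorem1 :
    ∃ c : ℝ, 0 < c ∧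
      ∀ (d : ℕ) (Ω : Set (EuclideanSpace ℝ (Fin d))) [CompactSpace Ω]
        (ν : Measure Ω) [IsProbabilityMeasure ν]
        (m s k J N : ℕ) (p B : ℝ) (u : Fin N → C(Ω, ℝ)) (ξ : Fin m → Ω),
        1 ≤ m → 1 ≤ s → 2 ≤ k → 1 ≤ J → 1 ≤ N → 1 ≤ p → 0 < B →
        -- the columns of the sampled dictionary are nonzero, and `s < s̄`
        (∀ i, ∃ j, u i (ξ j) ≠ 0) →
        0 < coherence (dictMatrix ξ u) →
        (s : ℝ) < sBar (dictMatrix ξ u) →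
        ∃ Φ : CNN k m N,
          (Φ.depth : ℝ) ≤ c * (J * max 1 (Real.logb k (m + N))) ∧
          (Φ.numParams : ℝ) ≤ c * (J * ((m : ℝ) + N) ^ 2) ∧
          ∀ f ∈ {f : C(Ω, ℝ) | ‖f‖ ≤ B},
            hammingNorm (Φ.eval (sample ξ f)) ≤ s ∧
            (∃ w, IsBestCoeff p s (dictMatrix ξ u) (sample ξ f) w) ∧
            (∀ w, IsBestCoeff p s (dictMatrix ξ u) (sample ξ f) w →
              ((∀ j, ξ j ∈ ν.support) →
                vecNorm p (w - Φ.eval (sample ξ f)) ≤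
                  C4 (dictMatrix ξ u) s p B * Real.exp (-C5 (dictMatrix ξ u) s * J) +
                    C6 (dictMatrix ξ u) s J p * worstErr u s ∞ ν {f : C(Ω, ℝ) | ‖f‖ ≤ B}) ∧
              vecNorm p (w - Φ.eval (sample ξ f)) ≤
                C4 (dictMatrix ξ u) s p B * Real.exp (-C5 (dictMatrix ξ u) s * J) +
                  C6 (dictMatrix ξ u) s J p *
                    worstErr u s (ENNReal.ofReal p) (mixedMeasure ν ξ)
                      {f : C(Ω, ℝ) | ‖f‖ ≤ B}) ∧
            (∀ C₁ : ℝ, OneSidedUD ν ξ u s p C₁ →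
              ((∀ j, ξ j ∈ ν.support) →
                LNorm (ENNReal.ofReal p) ν (f - combo u (Φ.eval (sample ξ f))) ≤
                  C7 m s p B C₁ * Real.exp (-C5 (dictMatrix ξ u) s * J) +
                    C8 (dictMatrix ξ u) s J p C₁ *
                      worstErr u s ∞ ν {f : C(Ω, ℝ) | ‖f‖ ≤ B}) ∧
              LNorm (ENNReal.ofReal p) ν (f - combo u (Φ.eval (sample ξ f))) ≤
                C7 m s p B C₁ * Real.exp (-C5 (dictMatrix ξ u) s * J) +
                  C8 (dictMatrix ξ u) s J p C₁ *
                    worstErr u s (ENNReal.ofReal p) (mixedMeasure ν ξ)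
                      {f : C(Ω, ℝ) | ‖f‖ ≤ B}) := by
  refine ⟨13, by norm_num, ?_⟩
  intro d Ω _ ν _ m s k J N p B u ξ hm hs hk hJ hN hp hB hcol hμ hsbar
  have hp0 : 0 < p := by linarith
  set A := dictMatrix ξ u with hAdef
  have hA : ∀ i, 0 < colNorm A i := fun i => colNorm_pos (hcol i)
  have hq0 := ratio_pos hs hμ
  have hq1 := ratio_lt_one hμ hsbar
  set σ := worstErr u s (ENNReal.ofReal p) (mixedMeasure ν ξ) {f : C(Ω, ℝ) | ‖f‖ ≤ B} with hσ
  have hσ0 : 0 ≤ σ := worstErr_nonneg _ _ _ _ _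
  have hε : 0 ≤ m * (2 ^ (1 / p) * σ) := by positivity
  have hG := geomConst_nonneg hq0 J
  have hc0 := c0_nonneg A
  obtain ⟨Φ, hdepth, hparams, hΦ⟩ :=
    exists_recovery_cnn (k := k) (by omega) hm hA hμ.le hs J (δ₀ := 4 * B * m * s) hε
  refine ⟨Φ, ?_, ?_, ?_⟩
  · have h1 := clog_le_max_logb_add_one (k := k) (M := m + N) (by omega) (by omega)
    have hJ' : (1 : ℝ) ≤ J := by exact_mod_cast hJ
    rw [hdepth]
    push_cast at h1 ⊢
    have h2 : (1 : ℝ) ≤ max 1 (Real.logb k (m + N)) := le_max_left _ _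
    nlinarith
  · exact_mod_cast hparams.trans (numParams_bound_le (by omega) hm hJ)
  intro f hf
  have hex := exists_isBestCoeff hm hp hA hμ.le hs hq1 (sample ξ f)
  -- the network recovers every best coefficient vector, with the same bound
  have key : ∀ w, IsBestCoeff p s A (sample ξ f) w →
      hammingNorm (Φ.eval (sample ξ f)) ≤ s ∧
      ∑ i, colNorm A i * |w i - Φ.eval (sample ξ f) i| ≤
        (2 * coherence A * s - coherence A) ^ J * (4 * B * m * s) +
          geomConst A s J * (m * (2 ^ (1 / p) * σ)) := by
    intro w hw
    have hres : ∑ t, |sample ξ f t - A.mulVec w t| ≤ m * (2 ^ (1 / p) * σ) := by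
      refine (sum_abs_le hm hp _).trans ?_
      refine mul_le_mul_of_nonneg_left ?_ (by positivity)
      have := empNorm_residual_le_worstErr (ν := ν) hm hp0 hf hw
      refine le_trans (le_of_eq ?_) this
      rw [hAdef, ← sample_combo]
      rfl
    obtain ⟨h1, h2⟩ := hΦ (sample ξ f) w hw.1 hres
      (sum_colNorm_bestCoeff_le hm hp hA hμ.le hs hq1 hf hw)
    exact ⟨h1, h2.trans (errBound_le_geomConst hq0 J hε _)⟩
  have hsparse : hammingNorm (Φ.eval (sample ξ f)) ≤ s := by
    obtain ⟨w, hw⟩ := hex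
    exact (key w hw).1
  have hqJ : 0 ≤ (2 * coherence A * s - coherence A) ^ J := pow_nonneg hq0.le J
  rw [exp_neg_C5 hq0]
  set Q := (2 * coherence A * s - coherence A) ^ J with hQ
  refine ⟨hsparse, hex, fun w hw => ?_, fun C₁ hUD => ?_⟩
  · have hmain : vecNorm p (w - Φ.eval (sample ξ f)) ≤
        C4 A s p B * Q + C6 A s J p * σ := by
      have hN1 : (1 : ℝ) ≤ (N : ℝ) ^ (1 - 1 / p) := by
        refine Real.one_le_rpow (by exact_mod_cast hN) ?_
        rw [sub_nonneg]
        exact (div_le_one hp0).2 hp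
      have h1 : 0 ≤ c0 A * (6 * B * m * s * Q + geomConst A s J * (m * (2 ^ (1 / p) * σ))) := by
        positivity
      calc vecNorm p (w - Φ.eval (sample ξ f))
          ≤ c0 A * ∑ i, colNorm A i * |w i - Φ.eval (sample ξ f) i| :=
            vecNorm_le_c0_mul hp hA _
        _ ≤ c0 A * (Q * (4 * B * m * s) + geomConst A s J * (m * (2 ^ (1 / p) * σ))) :=
            mul_le_mul_of_nonneg_left (key w hw).2 hc0
        _ ≤ c0 A * (6 * B * m * s * Q + geomConst A s J * (m * (2 ^ (1 / p) * σ))) := by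
            have : 0 ≤ B * m * s * Q := by positivity
            refine mul_le_mul_of_nonneg_left ?_ hc0
            linarith
        _ ≤ (c0 A * (6 * B * m * s * Q + geomConst A s J * (m * (2 ^ (1 / p) * σ)))) *
              (N : ℝ) ^ (1 - 1 / p) := le_mul_of_one_le_right h1 hN1
        _ = C4 A s p B * Q + C6 A s J p * σ := by
            rw [C4, C6]
            ring
    refine ⟨fun hξ => hmain.trans ?_, hmain⟩
    have hC6 : 0 ≤ C6 A s J p := by
      unfold C6
      positivity
    have := mul_le_mul_of_nonneg_left (worstErr_mixed_le_top u s hm hp0 hB.le ν hξ) hC6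
    linarith
  · have hC := hUD.1
    have hCm := Cmp_pos m p
    have hC3 := C3_nonneg (p := p) hC
    have hmain : LNorm (ENNReal.ofReal p) ν (f - combo u (Φ.eval (sample ξ f))) ≤
        C7 m s p B C₁ * Q + C8 A s J p C₁ * σ := by
      obtain ⟨w, hw⟩ := hex
      have h1 := LNorm_add_le (by simpa using hp : 1 ≤ ENNReal.ofReal p) ν (f - combo u w)
        (combo u w - combo u (Φ.eval (sample ξ f)))
      rw [sub_add_sub_cancel] at h1
      have h2 : LNorm (ENNReal.ofReal p) ν (f - combo u w) ≤ C3 p C₁ * σ :=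
        LNorm_residual_le_worstErr hm hp hf hUD hw
      have h3 := hUD.LNorm_le hp0 (combo_sub_mem_sparseSet u hw.1 hsparse)
      rw [← combo_sub, sample_combo] at h3
      have h4 := (empNorm_mulVec_le hm hp A (w - Φ.eval (sample ξ f))).trans
        (mul_le_mul_of_nonneg_left (key w hw).2 (by positivity))
      have h5 := h3.trans (mul_le_mul_of_nonneg_left h4 (by positivity))
      have h6 : C₁ ^ (-(1 / p)) * ((m : ℝ) ^ (-(1 / p)) * Cmp m p *
          (Q * (4 * B * m * s) + geomConst A s J * (m * (2 ^ (1 / p) * σ)))) =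
          C₁ ^ (-(1 / p)) * Cmp m p * (m : ℝ) ^ (1 - 1 / p) *
            (4 * B * s * Q + geomConst A s J * 2 ^ (1 / p) * σ) := by
        rw [← mul_rpow_neg_one_div hm p]
        ring
      rw [h6] at h5
      have h7 : (2 : ℝ) ^ (1 + 1 / p) = 2 * 2 ^ (1 / p) := by
        rw [Real.rpow_add two_pos, Real.rpow_one]
      have h8 : 0 ≤ C₁ ^ (-(1 / p)) * Cmp m p * (m : ℝ) ^ (1 - 1 / p) *
          (8 * B * s * Q + geomConst A s J * 2 ^ (1 / p) * σ) := by positivity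
      rw [← combo_sub] at h1
      rw [C7, C8, h7]
      linarith
    refine ⟨fun hξ => hmain.trans ?_, hmain⟩
    have hC8 : 0 ≤ C8 A s J p C₁ := by
      unfold C8
      positivity
    have := mul_le_mul_of_nonneg_left (worstErr_mixed_le_top u s hm hp0 hB.le ν hξ) hC8
    linarith
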